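/- Let $n,m\ge 0$ be integers, let $B\in\mathfrak{gl}(n,\mathbb C)$ be a matrix with simple spectrum ($n$ distinct eigenvalues), let $\tau\colon\mathbb C\to\mathbb C$ be an anti-holomorphic involution, and let $\sigma\in\mathbb C$, $|\sigma|=1$. Let $$\widetilde{\mathcal P}_{m,n}(B,\tau,\sigma)=\{L_\lambda=B_m\lambda^m+\dots+B_0 \mid B_k\in\mathfrak{gl}(n,\mathbb C),\ B_m=B,\ L_{\tau(\lambda)}=\sigma L_\lambda^*\ \text{for all }\lambda\in\mathbb C\}.$$ The gauge group $G=\{Q\in \mathrm U(n)\mid [Q,B]=0\}/\{\nu E\mid |\nu|=1\}$ acts on this space by $L_\lambda\mapsto Q^{-1}L_\lambda Q$. Let $\mathcal L$ be a smooth embedded submanifold (without boundary) of the real vector space of matrix polynomials of degree at most $m$, such that $\mathcal L\subset\widetilde{\mathcal P}_{m,n}(B,\tau,\sigma)$. Consider a dynamical system on $\mathcal L$, given by a $C^1$ vector field on $\mathcal L$ (in particular, any smooth one), which has the Lax form $$\frac{d}{dt}L_\lambda=[L_\lambda,A_\lambda(L_\lambda)]$$ for some map $A_\lambda\colon\mathcal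 L\to\mathfrak{gl}(n,\mathbb C)\otimes\mathbb C(\lambda)$. Let $L^0_\lambda\in\mathcal L$, and let $C=\{(\lambda,\mu)\in\mathbb C^2\mid \det(L^0_\lambda-\mu E)=0\}$ be its spectral curve. Assume that 1. all singular points of $C$ are fixed points of the involution $(\lambda,\mu)\mapsto(\tau(\lambda),\sigma\bar\mu)$; 2. each irreducible component of $C$ is smooth (as an affine curve) and has genus zero, i.e. its normalized compactification carries no non-zero holomorphic differentials; 3. at each common point of two distinct irreducible components of $C$ their intersection multiplicity is at most $2$; 4. the intersection of the $G$-orbit of $L^0_\lambda$ with $\mathcal L$ is a discrete set, i.e. its subspace topology is discrete. Then $L^0_\lambda$ is a Lyapunov stable fixed point of the system: the vector field vanishes at $L^0_\lambda$, and for each neighbourhood $U$ of $L^0_\lambda$ in $\mathcal L$ there is a neighbourhood $W$ of $L^0_\lambda$ in $\mathcal L$ such that each solution with initial point in $W$ extends to all $t\ge0$ and stays in $U$ for all $t\ge 0$. -/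

import Mathlib

open Polynomial Set
open scoped Manifold ContDiff Topology Matrix

noncomputable section

namespace LaxStability

/-! ### Matrix polynomials -/

/-- Matrix polynomials `L_λ = B_m λ^m + ⋯ + B_0` with coefficients in `gl(n, ℂ)`, given by the tuple
`(B_0, …, B_m)` of arrays of entries; a finite-dimensional real normed space. -/
abbrev MatPoly (n m : ℕ) : Type := Fin (m + 1) → Fin n → Fin n → ℂ

variable {n m : ℕ}

/-- The coefficient `B_k` of `L_λ = B_m λ^m + ⋯ + B_0`. -/
def MatPoly.coeff (L : MatPoly n m) (k : Fin (m + 1)) : Matrix (Fin n) (Fin n) ℂ :=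
  Matrix.of (L k)

/-- The value of the matrix polynomial `L` at the number `z`. -/
def MatPoly.eval (L : MatPoly n m) (z : ℂ) : Matrix (Fin n) (Fin n) ℂ :=
  ∑ k : Fin (m + 1), z ^ (k : ℕ) • L.coeff k

/-- `L` as a matrix with entries in `ℂ[λ]`. -/
def MatPoly.toPolyMatrix (L : MatPoly n m) : Matrix (Fin n) (Fin n) ℂ[X] :=
  ∑ k : Fin (m + 1), (X ^ (k : ℕ) : ℂ[X]) • (L.coeff k).map C

/-- `L` as a matrix with entries in `ℂ(λ)`. -/
def MatPoly.toRatMatrix (L : MatPoly n m) : Matrix (Fin n) (Fin n) (RatFunc ℂ) :=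
  L.toPolyMatrix.map (algebraMap ℂ[X] (RatFunc ℂ))

/-- An anti-holomorphic involution of the complex plane. -/
def IsAntiholomorphicInvolution (τ : ℂ → ℂ) : Prop :=
  Function.Involutive τ ∧ Differentiable ℂ (fun z => (starRingEnd ℂ) (τ z))

/-- The space of matrix polynomials with leading term `B` such that `L_{τ(λ)} = σ L_λ^*`. -/
def realMatPoly (n m : ℕ) (B : Matrix (Fin n) (Fin n) ℂ) (τ : ℂ → ℂ) (σ : ℂ) :
    Set (MatPoly n m) :=
  {L | L.coeff (Fin.last m) = B ∧ ∀ z : ℂ, L.eval (τ z) = σ • (L.eval z)ᴴ}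

/-- The orbit of `L` under the gauge group `{Q ∈ U(n) | [Q, B] = 0} / {ν E | |ν| = 1}`, which acts
by `L ↦ Q⁻¹ L Q` (scalar matrices act trivially). -/
def gaugeOrbit (B : Matrix (Fin n) (Fin n) ℂ) (L : MatPoly n m) : Set (MatPoly n m) :=
  {M | ∃ Q : Matrix.unitaryGroup (Fin n) ℂ,
    (Q : Matrix (Fin n) (Fin n) ℂ) * B = B * (Q : Matrix (Fin n) (Fin n) ℂ) ∧
    ∀ k, M.coeff k = ((Q⁻¹ : Matrix.unitaryGroup (Fin n) ℂ) : Matrix (Fin n) (Fin n) ℂ) * L.coeff k *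
      (Q : Matrix (Fin n) (Fin n) ℂ)}

/-- All the `n` eigenvalues of `B` are distinct. -/
def HasSimpleSpectrum (B : Matrix (Fin n) (Fin n) ℂ) : Prop :=
  B.charpoly.roots.Nodup

/-! ### Plane algebraic curves

Polynomials in two variables `(λ, μ)` are elements of `ℂ[X][X]`; the inner variable is `λ` and the
outer variable is `μ`, so that `evalEval a b P` is `P(a, b)`. -/

/-- The polynomial `P(λ, μ) = det (L_λ - μ E)`, the equation of the spectral curve. -/
def spectralPoly (L : MatPoly n m) : ℂ[X][X] :=
  (L.toPolyMatrix.map C - (X : ℂ[X][X]) • (1 : Matrix (Fin n) (Fin n) ℂ[X][X])).det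

/-- `(a, b)` is a singular point of the curve `P = 0` (for a polynomial `P` without multiple
factors): `P`, `∂P/∂λ` and `∂P/∂μ` vanish there. -/
def IsSingularPoint (P : ℂ[X][X]) (a b : ℂ) : Prop :=
  P.evalEval a b = 0 ∧
  (derivative (P.eval (C b))).eval a = 0 ∧
  (derivative (P.map (evalRingHom a))).eval b = 0

/-- The irreducible components of the curve `P = 0` are the curves `f = 0`, where `f` runs over the
irreducible factors of `P`, considered up to constant factors. -/
def IsComponent (P f : ℂ[X][X]) : Prop := Irreducible f ∧ f ∣ P

/-- The curve `f = 0` is smooth (as an affine curve). -/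
def IsSmoothCurve (f : ℂ[X][X]) : Prop := ∀ a b : ℂ, ¬ IsSingularPoint f a b

/-- The regular differentials of a function field `F` over `ℂ`: those that lie in `V dV` for each
place of `F`, i.e. each valuation ring `V` of `F` that contains `ℂ`. These are the holomorphic
differentials on the smooth compact model of `F`. -/
def regularDifferentials (F : Type*) [Field F] [Algebra ℂ F] : Submodule ℂ (KaehlerDifferential ℂ F) :=
  ⨅ (V : ValuationSubring F) (_ : ∀ c : ℂ, algebraMap ℂ F c ∈ V),
    Submodule.span ℂ {η | ∃ a ∈ V, ∃ b ∈ V, η = a • KaehlerDifferential.D ℂ F b}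

/-- The genus of a function field over `ℂ`: the dimension of the space of regular differentials. -/
def functionFieldGenus (F : Type*) [Field F] [Algebra ℂ F] : Cardinal :=
  Module.rank ℂ (regularDifferentials F)

/-- The genus of the normalized compactification of the irreducible curve `f = 0`. Its function
field is the field of fractions of `ℂ[λ, μ] / (f)`. -/
def curveGenus (f : ℂ[X][X]) (hf : Irreducible f) : Cardinal :=
  haveI : IsDomain (AdjoinRoot f) := AdjoinRoot.isDomain_of_prime hf.prime
  functionFieldGenus (FractionRing (AdjoinRoot f))

/-- The maximal ideal of the polynomials that vanish at the point `(a, b)`. -/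
def pointIdeal (a b : ℂ) : Ideal ℂ[X][X] := RingHom.ker (evalEvalRingHom a b)

instance (a b : ℂ) : (pointIdeal a b).IsPrime :=
  RingHom.ker_isPrime (evalEvalRingHom a b)

/-- The dimension of `R_p / (f, g)`, where `R_p` is the localization of `R` at the prime `p`. -/
def localIntersectionOrder {R : Type*} [CommRing R] [Algebra ℂ R] (p : Ideal R) [p.IsPrime]
    (f g : R) : Cardinal :=
  Module.rank ℂ (Localization.AtPrime p ⧸
    Ideal.span {algebraMap R (Localization.AtPrime p) f, algebraMap R (Localization.AtPrime p) g})

/-- The order (multiplicity) of the intersection of the curves `f = 0` and `g = 0` at `(a, b)`: the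
dimension of `O / (f, g)`, where `O` is the local ring of the plane at `(a, b)`. -/
def intersectionOrder (f g : ℂ[X][X]) (a b : ℂ) : Cardinal :=
  localIntersectionOrder (pointIdeal a b) f g

/-- The assumptions on the spectral curve: the singular points are fixed by
`(λ, μ) ↦ (τ(λ), σ \bar μ)`, the irreducible components are smooth of genus zero, and distinct
components intersect with order at most two. -/
structure SpectralCurveConditions (τ : ℂ → ℂ) (σ : ℂ) (L : MatPoly n m) : Prop where
  singular_fixed : ∀ a b : ℂ, IsSingularPoint (spectralPoly L) a b →
    τ a = a ∧ σ * (starRingEnd ℂ) b = b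
  smooth : ∀ f, IsComponent (spectralPoly L) f → IsSmoothCurve f
  genus_zero : ∀ f (hf : IsComponent (spectralPoly L) f), curveGenus f hf.1 = 0
  order_le_two : ∀ f g, IsComponent (spectralPoly L) f → IsComponent (spectralPoly L) g →
    ¬ Associated f g → ∀ a b : ℂ, f.evalEval a b = 0 → g.evalEval a b = 0 →
    intersectionOrder f g a b ≤ 2

/-! ### Dynamical systems -/

section Dynamics

variable {d : ℕ} {M : Type*} [TopologicalSpace M] [ChartedSpace (EuclideanSpace ℝ (Fin d)) M]

/-- The system `ẋ = v(x)` on `M` takes the form `d/dt L_λ = [L_λ, A_λ]` if the points `x` of `M` are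
identified with matrix polynomials `L_λ = ι x`; here `A_λ` depends rationally on `λ`. -/
def IsLaxRepresentation (v : ∀ x : M, TangentSpace (𝓡 d) x) (ι : M → MatPoly n m)
    (A : M → Matrix (Fin n) (Fin n) (RatFunc ℂ)) : Prop :=
  ∀ x : M,
    MatPoly.toRatMatrix (mfderiv (𝓡 d) 𝓘(ℝ, MatPoly n m) ι x (v x) : MatPoly n m) =
      (ι x).toRatMatrix * A x - A x * (ι x).toRatMatrix

/-- `x₀` is a Lyapunov stable fixed point of `ẋ = v(x)`: it is a zero of `v`, and for each
neighbourhood `U` of `x₀` there is a neighbourhood `W` such that a solution that starts in `W` exists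
for all `t ≥ 0`, and each solution that starts in `W` stays in `U` as long as it is defined. -/
def IsLyapunovStableFixedPoint (v : ∀ x : M, TangentSpace (𝓡 d) x) (x₀ : M) : Prop :=
  v x₀ = 0 ∧
  ∀ U ∈ 𝓝 x₀, ∃ W ∈ 𝓝 x₀, ∀ x ∈ W,
    (∃ γ : ℝ → M, γ 0 = x ∧ IsMIntegralCurveOn γ v (Ici 0)) ∧
    ∀ (γ : ℝ → M) (T : ℝ), γ 0 = x → IsMIntegralCurveOn γ v (Icc 0 T) →
      ∀ t ∈ Icc 0 T, γ t ∈ U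

end Dynamics

end LaxStability

end

/-! A Lax equation moves `L_λ - μE` by commutators, so `det (L_λ - μE)` is a first integral. It
suffices that `L⁰` is isolated in its level set inside the phase manifold
(`isLyapunovStableFixedPoint_of_isolated`): on the frontier of a small compact neighbourhood the
first integral avoids the value at `L⁰` and all nearby values, so solutions that start close to `L⁰`
are trapped in a compact set and exist forever. Since the gauge orbit meets the manifold in a
discrete set, it remains to see that every isospectral `L` lies in the orbit
(`mem_gaugeOrbit_of_spectralValues_eq`). For `m = 0` this is trivial, as `L = B`.

The involution `τ` is the reflection in a line `ℓ`, and `L = σ L*` on `ℓ`, so `L` is normal there.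
Let the equation of the spectral curve split as `f g`. A common zero of `f` and `g` is a singular
point, hence lies over `ℓ`. The spectral projector of the `f`-part is `S / r`, with `r` the
resultant and `S` polynomial in `λ`. Over `ℓ` the matrix `S` is normal with `S² = r S`, so its
entries are bounded by `|r|`; as `r` vanishes only on `ℓ`, the projector is constant
(`exists_projector`). In a unitary eigenbasis of `B`, both `L` and `L⁰` are thus block diagonal,
with one block per component.

A component of degree `k` in `μ` has `k` distinct points over `λ = ∞`, because `B` has simple
spectrum. If `m (k - 1) ≥ 2`, then `dλ / (∂f/∂μ)` is a non-zero holomorphic differential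
(`curveGenus_ne_zero`), so genus zero leaves `k = 1`, or `k = 2` with `m = 1`. A block of size one
is read off from its component. In a block of size two the off-diagonal entries are constant, and
the component determines the diagonal and the product of these entries (`compare_rows`). By `L = σ
L*` the product fixes their moduli, and the remaining phases are removed by a diagonal unitary
matrix, which commutes with `B` (`exists_phases`). -/

noncomputable section

namespace LaxStability

/-! ### Uniform existence time and completeness of integral curves. -/

section IntegralCurves

variable {E : Type*} [NormedAddCommGroup E] [NormedSpace ℝ E]
  {H : Type*} [TopologicalSpace H] {I : ModelWithCorners ℝ E H}
  {M : Type*} [TopologicalSpace M] [ChartedSpace H M] [IsManifold I 1 M]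
  {v : (x : M) → TangentSpace I x}

/-- A solution of the system written in the chart at `x₀` gives an integral curve on `M`. -/
theorem isMIntegralCurveOn_extChartAt_symm {x₀ : M} {f : ℝ → E} {s : Set ℝ}
    (hf : ∀ t ∈ s, HasDerivAt f
      (tangentCoordChange I ((extChartAt I x₀).symm (f t)) x₀ ((extChartAt I x₀).symm (f t))
        (v ((extChartAt I x₀).symm (f t)))) t)
    (hs : ∀ t ∈ s, f t ∈ interior (extChartAt I x₀).target) :
    IsMIntegralCurveOn ((extChartAt I x₀).symm ∘ f) v s := by
  intro t ht
  let xₜ : M := (extChartAt I x₀).symm (f t)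
  let w : E := v xₜ
  have h : HasDerivAt f (tangentCoordChange I xₜ x₀ xₜ w) t := hf t ht
  have hf3 := hs t ht
  have hf3' := mem_of_mem_of_subset hf3 interior_subset
  have hft1 := mem_preimage.mp <|
    mem_of_mem_of_subset hf3' (extChartAt I x₀).target_subset_preimage_source
  have hft2 := mem_extChartAt_source (I := I) xₜ
  apply HasMFDerivAt.hasMFDerivWithinAt
  suffices hd : HasDerivAt (F := E) ((extChartAt I xₜ ∘ (extChartAt I x₀).symm) ∘ f) w t by
    refine ⟨(continuousAt_extChartAt_symm'' hf3').comp h.continuousAt, ?_⟩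
    have e : ContinuousLinearMap.smulRight (1 : ℝ →L[ℝ] ℝ) w =
      ContinuousLinearMap.toSpanSingleton ℝ w := by ext; simp
    have hd' : HasFDerivWithinAt ((extChartAt I xₜ ∘ (extChartAt I x₀).symm) ∘ f)
        (ContinuousLinearMap.smulRight (1 : ℝ →L[ℝ] ℝ) w) univ t := by
      rw [e]; exact hd.hasFDerivAt.hasFDerivWithinAt
    simp only [mfld_simps] at hd' ⊢
    exact hd'
  -- The derivative of `f` is `w` in the chart at `x₀`; changing back to the chart at `xₜ` returns
  -- `w`, so the chain rule finishes.
  have key : w = tangentCoordChange I x₀ xₜ xₜ (tangentCoordChange I xₜ x₀ xₜ w) := by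
    rw [tangentCoordChange_comp (x := x₀) ⟨⟨hft2, hft1⟩, hft2⟩]
    exact (tangentCoordChange_self (I := I) (x := xₜ) (z := xₜ) (v := w) hft2).symm
  rw [key]
  apply HasFDerivAt.comp_hasDerivAt _ _ h
  apply HasFDerivWithinAt.hasFDerivAt (s := range I) _ <|
    mem_nhds_iff.mpr ⟨interior (extChartAt I x₀).target,
      subset_trans interior_subset (extChartAt_target_subset_range ..),
      isOpen_interior, hf3⟩
  have := hasFDerivWithinAt_tangentCoordChange (I := I) (x := x₀) (y := xₜ) (z := xₜ) ⟨hft1, hft2⟩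
  rwa [show extChartAt I x₀ xₜ = f t from (extChartAt I x₀).right_inv hf3'] at this

/-- Near each point the integral curves of a `C^1` vector field exist for a uniform time. -/
theorem exists_uniform_time [CompleteSpace E] [BoundarylessManifold I M]
    (hv : ContMDiff I I.tangent 1 (fun x ↦ (⟨x, v x⟩ : TangentBundle I M))) (x₀ : M) :
    ∃ ε > 0, ∃ W ∈ 𝓝 x₀, ∀ x ∈ W, ∃ γ : ℝ → M, γ 0 = x ∧ IsMIntegralCurveOn γ v (Ioo (-ε) ε) := by
  have hx : I.IsInteriorPoint x₀ := BoundarylessManifold.isInteriorPoint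
  have hv' := hv x₀
  rw [contMDiffAt_iff] at hv'
  have hF := (hv'.2.contDiffAt (range_mem_nhds_isInteriorPoint hx)).snd
  obtain ⟨ε, hε, a, r, L, K, hr, hpl⟩ := IsPicardLindelof.of_contDiffAt_one hF
  obtain ⟨α, hα, hαc⟩ := (hpl 0).exists_forall_mem_closedBall_eq_hasDerivWithinAt_continuousOn
  set y₀ := extChartAt I x₀ x₀ with hy₀
  have hnb : Metric.closedBall y₀ (r : ℝ) ×ˢ Icc (0 - ε) (0 + ε) ∈ 𝓝 (y₀, (0 : ℝ)) :=
    prod_mem_nhds (Metric.closedBall_mem_nhds _ (by exact_mod_cast hr))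
      (Icc_mem_nhds (by linarith) (by linarith))
  have hα0 : α (y₀, 0) = y₀ := (hα y₀ (Metric.mem_closedBall_self r.2)).1
  have hopen : α ⁻¹' interior (extChartAt I x₀).target ∈ 𝓝 (y₀, (0 : ℝ)) := by
    refine (hαc.continuousAt hnb) (isOpen_interior.mem_nhds ?_)
    rw [hα0]; exact (I.isInteriorPoint_iff).mp hx
  -- Joint continuity of the local flow `α` at `(y₀, 0)` gives one time interval that serves all
  -- initial points near `y₀` and keeps the curves inside the chart.
  obtain ⟨u, hu, w, hw, huw⟩ := mem_nhds_prod_iff.mp (Filter.inter_mem hnb hopen)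
  obtain ⟨δ, hδ, hδw⟩ := Metric.mem_nhds_iff.mp (Filter.inter_mem hw
    (Ioo_mem_nhds (show (0 : ℝ) - ε < 0 by linarith) (show (0 : ℝ) < 0 + ε by linarith)))
  rw [Real.ball_eq_Ioo, zero_sub, zero_add] at hδw
  refine ⟨δ, hδ, (extChartAt I x₀).source ∩ extChartAt I x₀ ⁻¹' u,
    Filter.inter_mem (extChartAt_source_mem_nhds x₀) ((continuousAt_extChartAt x₀) hu),
    fun x hx ↦ ⟨(extChartAt I x₀).symm ∘ fun t ↦ α (extChartAt I x₀ x, t), ?_, ?_⟩⟩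
  · have h0 := (huw (Set.mk_mem_prod hx.2 (mem_of_mem_nhds hw))).1
    have := (hα (extChartAt I x₀ x) h0.1).1
    simp only [Function.comp]
    rw [this, (extChartAt I x₀).left_inv hx.1]
  · refine isMIntegralCurveOn_extChartAt_symm ?_ ?_
    · intro t ht
      have h0 := (huw (Set.mk_mem_prod hx.2 (hδw ht).1)).1
      exact ((hα _ h0.1).2 t h0.2).hasDerivAt (Icc_mem_nhds (hδw ht).2.1 (hδw ht).2.2)
    · intro t ht
      exact (huw (Set.mk_mem_prod hx.2 (hδw ht).1)).2

/-- The local result extends by compactness: finitely many neighbourhoods suffice, with the minimum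
of their times. -/
theorem IsCompact.exists_uniform_time [CompleteSpace E] [BoundarylessManifold I M]
    (hv : ContMDiff I I.tangent 1 (fun x ↦ (⟨x, v x⟩ : TangentBundle I M))) {K : Set M}
    (hK : IsCompact K) :
    ∃ ε > 0, ∀ x ∈ K, ∃ γ : ℝ → M, γ 0 = x ∧ IsMIntegralCurveOn γ v (Ioo (-ε) ε) := by
  refine hK.induction_on (p := fun K ↦ ∃ ε > 0, ∀ x ∈ K, ∃ γ : ℝ → M, γ 0 = x ∧
    IsMIntegralCurveOn γ v (Ioo (-ε) ε)) ⟨1, one_pos, by simp⟩ ?_ ?_ ?_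
  · rintro s t hst ⟨ε, hε, h⟩
    exact ⟨ε, hε, fun x hx ↦ h x (hst hx)⟩
  · rintro s t ⟨ε, hε, h⟩ ⟨ε', hε', h'⟩
    refine ⟨min ε ε', lt_min hε hε', fun x hx ↦ ?_⟩
    rcases hx with hx | hx
    · obtain ⟨γ, h0, hγ⟩ := h x hx
      exact ⟨γ, h0, hγ.mono (Ioo_subset_Ioo (neg_le_neg (min_le_left _ _)) (min_le_left _ _))⟩
    · obtain ⟨γ, h0, hγ⟩ := h' x hx
      exact ⟨γ, h0, hγ.mono (Ioo_subset_Ioo (neg_le_neg (min_le_right _ _)) (min_le_right _ _))⟩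
  · intro x _
    obtain ⟨ε, hε, W, hW, h⟩ := LaxStability.exists_uniform_time hv x
    exact ⟨W, mem_nhdsWithin_of_mem_nhds hW, ε, hε, h⟩

/-- Integral curves that start in an invariant set with uniform existence time are complete. -/
theorem exists_isMIntegralCurve_of_invariant [BoundarylessManifold I M] [T2Space M]
    (hv : ContMDiff I I.tangent 1 (fun x ↦ (⟨x, v x⟩ : TangentBundle I M))) {S : Set M} {ε : ℝ}
    (hε : 0 < ε)
    (hS : ∀ x ∈ S, ∃ γ : ℝ → M, γ 0 = x ∧ IsMIntegralCurveOn γ v (Ioo (-ε) ε))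
    (hinv : ∀ (γ : ℝ → M) (a : ℝ), γ 0 ∈ S → IsMIntegralCurveOn γ v (Ioo (-a) a) →
      ∀ t ∈ Ioo (-a) a, γ t ∈ S)
    {x : M} (hx : x ∈ S) : ∃ γ : ℝ → M, γ 0 = x ∧ IsMIntegralCurve γ v := by
  -- Each step gains `ε / 2` on both sides: at the times `±(a - ε / 2)` the curve is still in `S`,
  -- so a curve of lifetime `ε` can be restarted there and glued on.
  have step : ∀ k : ℕ, ∃ γ : ℝ → M, γ 0 = x ∧
      IsMIntegralCurveOn γ v (Ioo (-(ε + k * (ε / 2))) (ε + k * (ε / 2))) := by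
    intro k
    induction k with
    | zero => simpa using hS x hx
    | succ k ih =>
      obtain ⟨γ, h0, hγ⟩ := ih
      set a := ε + k * (ε / 2) with ha
      have haε : ε ≤ a := by rw [ha]; have : 0 ≤ k * (ε / 2) := by positivity
                             linarith
      have hS' : ∀ t ∈ Ioo (-a) a, γ t ∈ S := hinv γ a (h0 ▸ hx) hγ
      obtain ⟨γ1, h1, hγ1⟩ := hS _ (hS' (-(a - ε / 2)) ⟨by linarith, by linarith⟩)
      obtain ⟨γ2, h2, hγ2⟩ := hS _ (hS' (a - ε / 2) ⟨by linarith, by linarith⟩)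
      rw [← isMIntegralCurveOn_comp_add (dt := a - ε / 2)] at hγ1
      rw [← isMIntegralCurveOn_comp_sub (dt := a - ε / 2)] at hγ2
      simp_rw [Set.mem_Ioo, ← sub_lt_iff_lt_add, ← lt_sub_iff_add_lt, ← Set.mem_Ioo] at hγ1
      simp_rw [Set.mem_Ioo, lt_sub_iff_add_lt, sub_lt_iff_lt_add, ← Set.mem_Ioo] at hγ2
      set γ1' := γ1 ∘ (· + (a - ε / 2)) with hγ1'
      set γ2' := γ2 ∘ (· - (a - ε / 2)) with hγ2'
      have e1 : γ1' (-(a - ε / 2)) = γ (-(a - ε / 2)) := by simp [hγ1', h1]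
      have e2 : γ2' (a - ε / 2) = γ (a - ε / 2) := by simp [hγ2', h2]
      have hk : ε + ((k + 1 : ℕ) : ℝ) * (ε / 2) = a + ε / 2 := by rw [ha]; push_cast; ring
      rw [hk]
      refine ⟨piecewise (Ioo (-(a + ε / 2)) a) (piecewise (Ioo (-a) a) γ γ1') γ2', ?_, ?_⟩
      · rw [piecewise, if_pos ⟨by linarith, by linarith⟩, piecewise,
          if_pos ⟨by linarith, by linarith⟩, h0]
      · apply (isMIntegralCurveOn_piecewise (t₀ := a - ε / 2) hv _ hγ2
          ⟨⟨by linarith, by linarith⟩, ⟨by linarith, by linarith⟩⟩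
          (by rw [piecewise, if_pos ⟨by linarith, by linarith⟩, ← e2])).mono
          (Ioo_subset_Ioo_union_Ioo le_rfl (by linarith) (by linarith))
        exact (isMIntegralCurveOn_piecewise (t₀ := -(a - ε / 2)) hv hγ hγ1
          ⟨⟨by linarith, by linarith⟩, ⟨by linarith, by linarith⟩⟩ e1.symm).mono
          (union_comm _ _ ▸ Ioo_subset_Ioo_union_Ioo (by linarith) (by linarith) le_rfl)
  rw [exists_isMIntegralCurve_iff_exists_isMIntegralCurveOn_Ioo hv]
  intro a
  obtain ⟨k, hk⟩ := exists_nat_gt (a / (ε / 2))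
  obtain ⟨γ, h0, hγ⟩ := step k
  rw [div_lt_iff₀ (by positivity)] at hk
  exact ⟨γ, h0, hγ.mono (Ioo_subset_Ioo (by linarith) (by linarith))⟩

end IntegralCurves

/-! ### Lyapunov stability from first integrals. -/

section Stability

/-- A path on which the map `Φ` is constant and which starts in an open set `interior K`, at a point
whose `Φ`-fibre does not meet the frontier of `K`, stays there. -/
theorem mem_interior_of_fibre {M Y : Type*} [TopologicalSpace M] {Φ : M → Y}
    {K : Set M} {s : Set ℝ} (hs : IsPreconnected s) {γ : ℝ → M}
    (hγ : ContinuousOn γ s) {t₀ : ℝ} (ht₀ : t₀ ∈ s) (hΦ : ∀ t ∈ s, Φ (γ t) = Φ (γ t₀))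
    (h0 : γ t₀ ∈ interior K) (hfr : Φ (γ t₀) ∉ Φ '' frontier K) :
    ∀ t ∈ s, γ t ∈ interior K := by
  have hpre : IsPreconnected (γ '' s) := hs.image γ hγ
  have hsub : γ '' s ⊆ interior K ∪ interior Kᶜ := by
    rintro _ ⟨t, ht, rfl⟩
    by_contra hcon
    apply hfr
    rw [← hΦ t ht]
    refine mem_image_of_mem _ ?_
    rw [interior_compl, mem_union, not_or, mem_compl_iff, not_not] at hcon
    exact ⟨hcon.2, hcon.1⟩
  have := hpre.subset_left_of_subset_union isOpen_interior isOpen_interior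
    (disjoint_compl_right.mono interior_subset interior_subset) hsub
    ⟨γ t₀, mem_image_of_mem _ ht₀, h0⟩
  exact fun t ht ↦ this (mem_image_of_mem _ ht)

variable {d : ℕ} {M : Type*} [TopologicalSpace M] [ChartedSpace (EuclideanSpace ℝ (Fin d)) M]
  [IsManifold (𝓡 d) 1 M] [T2Space M]

/-- A point that is isolated in the common level set of the first integrals of a `C^1` vector field
is a Lyapunov stable fixed point. -/
theorem isLyapunovStableFixedPoint_of_isolated {Y : Type*} [TopologicalSpace Y] [T2Space Y]
    {v : ∀ x : M, TangentSpace (𝓡 d) x}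
    (hv : ContMDiff (𝓡 d) (𝓡 d).tangent 1 (fun x => (⟨x, v x⟩ : TangentBundle (𝓡 d) M)))
    {Φ : M → Y} (hΦ : Continuous Φ)
    (hconst : ∀ (γ : ℝ → M) (s : Set ℝ), Convex ℝ s → IsMIntegralCurveOn γ v s →
      ∀ t ∈ s, ∀ t' ∈ s, Φ (γ t) = Φ (γ t'))
    {x₀ : M} {N : Set M} (hN : N ∈ 𝓝 x₀) (hiso : ∀ x ∈ N, Φ x = Φ x₀ → x = x₀) :
    IsLyapunovStableFixedPoint v x₀ := by
  have : LocallyCompactSpace M := ChartedSpace.locallyCompactSpace (EuclideanSpace ℝ (Fin d)) M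
  constructor
  · obtain ⟨γ, h0, hγ⟩ := exists_isMIntegralCurveAt_of_contMDiffAt_boundaryless 0 (hv x₀)
    -- The solution through `x₀` remains in `N` for small times and keeps its `Φ`-value, so it is
    -- constant; its derivative `v x₀` is then zero.
    have hc : γ =ᶠ[𝓝 0] fun _ ↦ x₀ := by
      obtain ⟨ε, hε, hγ'⟩ := isMIntegralCurveAt_iff'.mp hγ
      have hn : γ ⁻¹' N ∈ 𝓝 0 := hγ.continuousAt (by rwa [h0])
      filter_upwards [hn, Metric.ball_mem_nhds 0 hε] with t ht htb
      refine hiso _ ht ?_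
      rw [← h0]
      exact hconst γ _ (convex_ball _ _) hγ' t htb 0 (Metric.mem_ball_self hε)
    have h1 := hγ.hasMFDerivAt
    have h2 : HasMFDerivAt 𝓘(ℝ, ℝ) (𝓡 d) γ 0 (0 : TangentSpace 𝓘(ℝ, ℝ) (0 : ℝ) →L[ℝ] TangentSpace (𝓡 d) x₀) :=
      (hasMFDerivAt_const x₀ (0 : ℝ)).congr_of_eventuallyEq hc
    have h3 := hasMFDerivAt_unique h1 h2
    have h4 : (1 : ℝ) • v (γ 0) = 0 := congrArg (fun f : ℝ →L[ℝ] EuclideanSpace ℝ (Fin d) ↦ f 1) h3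
    rw [one_smul, h0] at h4
    exact h4
  · intro U hU
    obtain ⟨K, hK, hKs, hKc⟩ := local_compact_nhds (Filter.inter_mem hU hN)
    have hfrc : IsCompact (frontier K) := hKc.of_isClosed_subset isClosed_frontier hKc.isClosed.frontier_subset
    have hcl : IsClosed (Φ '' frontier K) := (hfrc.image hΦ).isClosed
    have hx0 : Φ x₀ ∉ Φ '' frontier K := by
      rintro ⟨y, hy, hyx⟩
      have : y = x₀ := hiso y (hKs (hKc.isClosed.frontier_subset hy)).2 hyx
      exact hy.2 (this ▸ mem_interior_iff_mem_nhds.mpr hK)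
    -- Values of `Φ` attained on the frontier are excluded. A curve from `W` therefore cannot cross
    -- the frontier, and `W` is invariant.
    set W := interior K ∩ Φ ⁻¹' (Φ '' frontier K)ᶜ with hW
    have hWn : W ∈ 𝓝 x₀ := Filter.inter_mem (interior_mem_nhds.mpr hK)
      (hΦ.continuousAt (hcl.isOpen_compl.mem_nhds hx0))
    have hstay : ∀ (γ : ℝ → M) (s : Set ℝ), Convex ℝ s → IsMIntegralCurveOn γ v s → (0 : ℝ) ∈ s →
        γ 0 ∈ W → ∀ t ∈ s, γ t ∈ W := by
      intro γ s hs hγ h0 hγ0 t ht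
      refine ⟨mem_interior_of_fibre (Φ := Φ) hs.isPreconnected hγ.continuousOn h0
        (fun t ht ↦ hconst γ s hs hγ t ht 0 h0) hγ0.1 hγ0.2 t ht, ?_⟩
      have := hconst γ s hs hγ t ht 0 h0
      rw [mem_preimage, this]
      exact hγ0.2
    obtain ⟨ε, hε, hunif⟩ := IsCompact.exists_uniform_time hv hKc
    refine ⟨W, hWn, fun x hx ↦ ⟨?_, ?_⟩⟩
    · obtain ⟨γ, h0, hγ⟩ := exists_isMIntegralCurve_of_invariant hv hε
        (fun x hx ↦ hunif x (interior_subset hx.1))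
        (fun γ a hγ0 hγ t ht ↦ hstay γ _ (convex_Ioo _ _) hγ ⟨by linarith [ht.1, ht.2], by linarith [ht.1, ht.2]⟩ hγ0 t ht) hx
      exact ⟨γ, h0, hγ.isMIntegralCurveOn _⟩
    · intro γ T h0 hγ t ht
      exact (hKs (interior_subset (hstay γ _ (convex_Icc _ _) hγ ⟨le_rfl, ht.1.trans ht.2⟩
        (h0 ▸ hx) t ht).1)).1

end Stability

/-! ### The spectral polynomial is a first integral. -/

section FirstIntegrals

variable {n m : ℕ}

theorem MatPoly.eval_apply (L : MatPoly n m) (z : ℂ) (i j : Fin n) :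
    L.eval z i j = ∑ k : Fin (m + 1), z ^ (k : ℕ) * L k i j := by
  rw [MatPoly.eval, Matrix.sum_apply]
  rfl

theorem MatPoly.toPolyMatrix_apply (L : MatPoly n m) (i j : Fin n) :
    L.toPolyMatrix i j = ∑ k : Fin (m + 1), X ^ (k : ℕ) * C (L k i j) := by
  rw [MatPoly.toPolyMatrix, Matrix.sum_apply]
  rfl

theorem MatPoly.map_eval_toPolyMatrix (L : MatPoly n m) (z : ℂ) :
    L.toPolyMatrix.map (evalRingHom z) = L.eval z := by
  ext i j
  rw [Matrix.map_apply, toPolyMatrix_apply, eval_apply, map_sum]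
  refine Finset.sum_congr rfl fun k _ ↦ ?_
  simp only [coe_evalRingHom, eval_mul, eval_pow, eval_X, eval_C]

/-- Jacobi's formula. -/
theorem hasDerivWithinAt_det {N : ℝ → Fin n → Fin n → ℂ} {N' : Fin n → Fin n → ℂ} {s : Set ℝ}
    {t : ℝ} (h : HasDerivWithinAt N N' s t) :
    HasDerivWithinAt (fun t ↦ (Matrix.of (N t)).det)
      ((Matrix.of (N t)).adjugate * Matrix.of N').trace s t := by
  let D : ContinuousMultilinearMap ℝ (fun _ : Fin n ↦ Fin n → ℂ) ℂ :=
    { toMultilinearMap := (Matrix.detRowAlternating (R := ℂ) (n := Fin n)).toMultilinearMap.restrictScalars ℝ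
      cont := (continuous_id (X := Matrix (Fin n) (Fin n) ℂ)).matrix_det }
  have h1 := (D.hasFDerivAt (N t)).comp_hasDerivWithinAt t h
  have h2 : D.linearDeriv (N t) N' = ((Matrix.of (N t)).adjugate * Matrix.of N').trace := by
    rw [ContinuousMultilinearMap.linearDeriv_apply, Matrix.trace_mul_comm, Matrix.trace]
    refine Finset.sum_congr rfl fun i _ ↦ ?_
    have : D (Function.update (N t) i (N' i)) = ((Matrix.of (N t)).updateRow i (N' i)).det := rfl
    rw [this, ← Matrix.det_transpose, ← Matrix.updateCol_transpose, ← Matrix.cramer_apply,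
      Matrix.cramer_eq_adjugate_mulVec, ← Matrix.adjugate_transpose, Matrix.mulVec_transpose]
    rfl
  rw [h2] at h1
  exact h1

theorem map_trace_adjugate_mul {R S : Type*} [CommRing R] [CommRing S] (φ : R →+* S)
    (N N' : Matrix (Fin n) (Fin n) R) :
    φ (N.adjugate * N').trace = ((N.map φ).adjugate * N'.map φ).trace := by
  have : (N.adjugate * N').map φ = (N.map φ).adjugate * N'.map φ := by
    rw [Matrix.map_mul]
    exact congrArg (· * N'.map φ) (φ.map_adjugate N)
  rw [← this, Matrix.trace, map_sum]
  rfl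

/-- Both `adj(N) N` and `N adj(N)` are `det N` times the identity, so by cyclicity of the trace the
two terms are equal. -/
theorem trace_adjugate_mul_commutator {R : Type*} [CommRing R] (N A : Matrix (Fin n) (Fin n) R) :
    (N.adjugate * (N * A - A * N)).trace = 0 := by
  rw [mul_sub, Matrix.trace_sub, ← mul_assoc, Matrix.adjugate_mul, ← mul_assoc,
    Matrix.trace_mul_comm _ N, ← mul_assoc, Matrix.mul_adjugate, sub_self]

/-- By Jacobi's formula this is the derivative of `det (L_z - μE)` along the flow. The identity is
proved over `ℂ(λ)`, where `A` lives, then descends to `ℂ[λ]`, so that it can be evaluated at every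
`z`, even at a pole of `A`. -/
theorem trace_adjugate_mul_eq_zero_of_lax {L L' : MatPoly n m}
    {A : Matrix (Fin n) (Fin n) (RatFunc ℂ)}
    (h : L'.toRatMatrix = L.toRatMatrix * A - A * L.toRatMatrix) (z μ : ℂ) :
    ((L.eval z - μ • 1).adjugate * L'.eval z).trace = 0 := by
  have hpoly : ((L.toPolyMatrix - Matrix.scalar (Fin n) (C μ)).adjugate * L'.toPolyMatrix).trace = 0 := by
    apply IsFractionRing.injective ℂ[X] (RatFunc ℂ)
    rw [map_zero, map_trace_adjugate_mul, Matrix.map_sub _ (map_sub _)]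
    have h0 : (Matrix.scalar (Fin n) (C μ)).map (algebraMap ℂ[X] (RatFunc ℂ)) =
        Matrix.scalar (Fin n) (algebraMap ℂ[X] (RatFunc ℂ) (C μ)) := by
      simp [Matrix.scalar_apply, Matrix.diagonal_map]
    -- Subtracting a scalar matrix from `L` does not change the commutator with `A`.
    have h1 : L'.toRatMatrix = (L.toRatMatrix - Matrix.scalar (Fin n) (algebraMap ℂ[X] (RatFunc ℂ) (C μ))) * A -
        A * (L.toRatMatrix - Matrix.scalar (Fin n) (algebraMap ℂ[X] (RatFunc ℂ) (C μ))) := by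
      have := (Matrix.scalar_commute (algebraMap ℂ[X] (RatFunc ℂ) (C μ)) (Commute.all _) A).eq
      rw [h, sub_mul, mul_sub, this]
      abel
    rw [h0]
    change ((L.toRatMatrix - _).adjugate * L'.toRatMatrix).trace = 0
    rw [h1, trace_adjugate_mul_commutator]
  have := congrArg (evalRingHom z) hpoly
  rw [map_zero, map_trace_adjugate_mul, Matrix.map_sub _ (map_sub _), MatPoly.map_eval_toPolyMatrix,
    MatPoly.map_eval_toPolyMatrix] at this
  rw [← this]
  congr 4
  ext i j
  rcases eq_or_ne i j with rfl | hij
  · simp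
  · simp [hij]

variable {d : ℕ} {M : Type*} [TopologicalSpace M] [ChartedSpace (EuclideanSpace ℝ (Fin d)) M]

/-- The values `det (L_λ - μ E)`, as a function of `(λ, μ)`. -/
def spectralValues (L : MatPoly n m) (p : ℂ × ℂ) : ℂ := (L.eval p.1 - p.2 • 1).det

theorem continuous_spectralValues : Continuous (spectralValues (n := n) (m := m)) := by
  refine continuous_pi fun p ↦ Continuous.matrix_det (Continuous.sub ?_ continuous_const)
  refine continuous_matrix fun i j ↦ ?_
  simp only [MatPoly.eval_apply]
  fun_prop

/-- The spectral curve is preserved by a system in Lax form. -/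
theorem spectralValues_eq_of_lax {ι : M → MatPoly n m}
    (hι : MDifferentiable (𝓡 d) 𝓘(ℝ, MatPoly n m) ι)
    {v : ∀ x : M, TangentSpace (𝓡 d) x} {A : M → Matrix (Fin n) (Fin n) (RatFunc ℂ)}
    (hLax : IsLaxRepresentation v ι A) {γ : ℝ → M} {s : Set ℝ} (hs : Convex ℝ s)
    (hγ : IsMIntegralCurveOn γ v s) {t t' : ℝ} (ht : t ∈ s) (ht' : t' ∈ s) :
    spectralValues (ι (γ t)) = spectralValues (ι (γ t')) := by
  funext p
  have hd : ∀ t ∈ s, HasDerivWithinAt (fun t ↦ spectralValues (ι (γ t)) p) 0 s t := by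
    intro t ht
    let w : MatPoly n m := mfderiv (𝓡 d) 𝓘(ℝ, MatPoly n m) ι (γ t) (v (γ t))
    have h1 : HasDerivWithinAt (ι ∘ γ) w s t := by
      have h0 := ((hι (γ t)).hasMFDerivAt.comp_hasMFDerivWithinAt t (hγ t ht))
      rw [hasMFDerivWithinAt_iff_hasFDerivWithinAt] at h0
      have h3 : ((mfderiv (𝓡 d) 𝓘(ℝ, MatPoly n m) ι (γ t)).comp
          (ContinuousLinearMap.smulRight (1 : ℝ →L[ℝ] ℝ) (v (γ t))) : ℝ →L[ℝ] MatPoly n m) =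
          ContinuousLinearMap.toSpanSingleton ℝ w := by
        refine ContinuousLinearMap.ext_ring ?_
        change mfderiv (𝓡 d) 𝓘(ℝ, MatPoly n m) ι (γ t) ((1 : ℝ) • v (γ t)) = (1 : ℝ) • w
        rw [one_smul, one_smul]
      have h4 : HasFDerivWithinAt (ι ∘ γ) (ContinuousLinearMap.toSpanSingleton ℝ w) s t := by
        rw [← h3]; exact h0
      exact hasDerivWithinAt_iff_hasFDerivWithinAt.mpr h4
    have h4 : HasDerivWithinAt (fun t i j ↦ ((ι (γ t)).eval p.1 - p.2 • 1) i j)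
        (fun i j ↦ w.eval p.1 i j) s t := by
      refine hasDerivWithinAt_pi.mpr fun i ↦ hasDerivWithinAt_pi.mpr fun j ↦ ?_
      simp only [Matrix.sub_apply, MatPoly.eval_apply]
      refine (HasDerivWithinAt.fun_sum fun k _ ↦ ?_).sub_const _
      exact (hasDerivWithinAt_pi.mp (hasDerivWithinAt_pi.mp
        (hasDerivWithinAt_pi.mp h1 k) i) j).const_mul _
    have h5 := hasDerivWithinAt_det h4
    have h6 := trace_adjugate_mul_eq_zero_of_lax (L := ι (γ t)) (L' := w) (hLax (γ t)) p.1 p.2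
    exact h6 ▸ h5
  have := hs.norm_image_sub_le_of_norm_hasDerivWithin_le hd (C := 0) (fun _ _ ↦ by simp) ht' ht
  rw [zero_mul] at this
  exact sub_eq_zero.mp (norm_le_zero_iff.mp this)

end FirstIntegrals

/-! ### Anti-holomorphic involutions of the plane are reflections. -/

section Involutions

open ComplexConjugate

/-- An entire function of at most linear growth is affine. -/
theorem exists_affine_of_linear_growth {g : ℂ → ℂ} (hg : Differentiable ℂ g) {K : ℝ}
    (hK : ∀ z, ‖g z‖ ≤ K * (1 + ‖z‖)) : ∃ a b : ℂ, ∀ z, g z = a * z + b := by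
  have hK0 : 0 ≤ K := by
    have := (norm_nonneg _).trans (hK 0)
    simpa using this
  have hder : ∀ z, ‖deriv g z‖ ≤ 2 * K := by
    intro z
    have hR : 0 < 1 + ‖z‖ := by positivity
    -- Cauchy's estimate on the circle of radius `1 + ‖z‖`, where `1 + ‖w‖ ≤ 2 (1 + ‖z‖)`; the
    -- derivative is bounded, so Liouville's theorem applies to it.
    have h := Complex.norm_deriv_le_of_forall_mem_sphere_norm_le (c := z) (R := 1 + ‖z‖)
      (C := 2 * K * (1 + ‖z‖)) hR hg.diffContOnCl fun w hw ↦ by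
        refine (hK w).trans ?_
        have : ‖w‖ ≤ ‖z‖ + (1 + ‖z‖) := by
          rw [mem_sphere_iff_norm] at hw
          calc ‖w‖ = ‖z + (w - z)‖ := by ring_nf
            _ ≤ _ := (norm_add_le _ _).trans (by rw [hw])
        nlinarith
    rwa [mul_div_assoc, div_self hR.ne', mul_one] at h
  have hd : Differentiable ℂ (deriv g) := (hg.contDiff (n := 2)).differentiable_deriv_two
  have hconst := hd.apply_eq_apply_of_bounded
    (isBounded_iff_forall_norm_le.mpr ⟨2 * K, by rintro _ ⟨z, rfl⟩; exact hder z⟩)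
  refine ⟨deriv g 0, g 0, fun z ↦ ?_⟩
  have hd2 : Differentiable ℂ (fun z ↦ g z - deriv g 0 * z) := by fun_prop
  have := is_const_of_deriv_eq_zero hd2 (fun w ↦ by
    rw [deriv_fun_sub (hg w) (by fun_prop), deriv_const_mul _ differentiableAt_id, deriv_id'', hconst w 0]
    ring) z 0
  simp only [mul_zero, sub_zero] at this
  rw [← this]; ring

/-- An anti-holomorphic involution of the plane is the reflection in a line. -/
theorem IsAntiholomorphicInvolution.exists_line {τ : ℂ → ℂ} (hτ : IsAntiholomorphicInvolution τ) :
    ∃ α β : ℂ, α ≠ 0 ∧ ∀ w, τ (β + α * w) = β + α * conj w := by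
  obtain ⟨hinv, hh⟩ := hτ
  set h : ℂ → ℂ := fun z ↦ conj (τ z) with hdef
  have hτh : ∀ z, τ z = conj (h z) := fun z ↦ by simp [hdef]
  have hτc : Continuous τ := by
    have : τ = fun z ↦ conj (h z) := funext hτh
    rw [this]; exact Complex.continuous_conj.comp hh.continuous
  have hinj : Function.Injective h := fun a b hab ↦ hinv.injective ((starRingEnd ℂ).injective hab)
  obtain ⟨z₀, hz₀⟩ : ∃ z₀, h z₀ = 0 := ⟨τ 0, by simp [hdef, hinv 0]⟩
  -- `conj ∘ h ∘ conj` is the inverse of `h`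
  have hcomp : ∀ z, conj (h (conj (h z))) = z := fun z ↦ by
    rw [← hτh, ← hτh, hinv z]
  have hder : deriv h z₀ ≠ 0 := by
    intro h0
    have h1 : HasDerivAt h 0 z₀ := h0 ▸ (hh z₀).hasDerivAt
    have h2 : HasDerivAt (fun z ↦ conj (h (conj z))) (conj (deriv h (conj (h z₀)))) (h z₀) := by
      have := (hh (conj (h z₀))).hasDerivAt.conj_conj
      rw [Complex.conj_conj (h z₀)] at this
      exact this
    have h3 := h2.comp z₀ h1
    have h4 : ((fun z ↦ conj (h (conj z))) ∘ h) = id := funext hcomp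
    rw [h4, mul_zero] at h3
    exact zero_ne_one (h3.unique (hasDerivAt_id z₀))
  -- By injectivity `z₀` is the only zero of `h`, and it is simple, so `h(z) / (z - z₀)` is entire
  -- without zeros.
  have hds : Differentiable ℂ (dslope h z₀) := by
    rw [← differentiableOn_univ]
    exact (Complex.differentiableOn_dslope Filter.univ_mem).mpr hh.differentiableOn
  have hds0 : ∀ z, dslope h z₀ z ≠ 0 := by
    intro z
    rcases eq_or_ne z z₀ with rfl | hz
    · rwa [dslope_same]
    · rw [dslope_of_ne _ hz, slope_def_field, hz₀, sub_zero]
      exact div_ne_zero (fun h0 ↦ hz (hinj (h0.trans hz₀.symm))) (sub_ne_zero.mpr hz)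
  have hgd : Differentiable ℂ fun z ↦ (dslope h z₀ z)⁻¹ := fun z ↦ (hds z).inv (hds0 z)
  -- The reciprocal `(z - z₀) / h(z)` grows at most linearly: this is clear where `|h| > 1`, and the
  -- set where `|h| ≤ 1` is compact, being the image under `τ` of the closed unit disc. An affine
  -- function without zeros is constant, so `h` is affine.
  obtain ⟨K, hK⟩ : ∃ K : ℝ, ∀ z, ‖(dslope h z₀ z)⁻¹‖ ≤ K * (1 + ‖z‖) := by
    have hcpt : IsCompact (τ '' Metric.closedBall 0 1) := (isCompact_closedBall 0 1).image hτc
    obtain ⟨K₁, hK₁⟩ := (hcpt.image hgd.continuous).isBounded.exists_norm_le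
    refine ⟨max K₁ (1 + ‖z₀‖), fun z ↦ ?_⟩
    by_cases hz : ‖τ z‖ ≤ 1
    · have : ‖(dslope h z₀ z)⁻¹‖ ≤ K₁ := hK₁ _ ⟨z, ⟨τ z, by simpa using hz, hinv z⟩, rfl⟩
      refine (this.trans (le_max_left _ (1 + ‖z₀‖))).trans (le_mul_of_one_le_right ?_ ?_)
      · exact (by positivity : (0 : ℝ) ≤ 1 + ‖z₀‖).trans (le_max_right _ _)
      · linarith [norm_nonneg z]
    · push Not at hz
      have hz' : 1 < ‖h z‖ := by simpa [hdef] using hz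
      have hne : z ≠ z₀ := by rintro rfl; rw [hz₀] at hz'; norm_num at hz'
      rw [dslope_of_ne _ hne, slope_def_field, hz₀, sub_zero, inv_div, norm_div]
      have h1 : ‖z - z₀‖ / ‖h z‖ ≤ ‖z - z₀‖ := div_le_self (norm_nonneg _) hz'.le
      refine h1.trans ((norm_sub_le _ _).trans ?_)
      have : (1 + ‖z₀‖) * (1 + ‖z‖) ≤ max K₁ (1 + ‖z₀‖) * (1 + ‖z‖) := by gcongr; exact le_max_right _ _
      nlinarith [norm_nonneg z, norm_nonneg z₀]
  obtain ⟨a, b, hab⟩ := exists_affine_of_linear_growth hgd hK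
  have ha : a = 0 := by
    by_contra ha
    have h0 := hab (-b / a)
    rw [mul_div_cancel₀ _ ha, neg_add_cancel] at h0
    exact hds0 _ (inv_eq_zero.mp h0)
  have hb : b ≠ 0 := by
    have := hab 0
    rw [ha, zero_mul, zero_add] at this
    rw [← this]; exact inv_ne_zero (hds0 0)
  have hform : ∀ z, h z = b⁻¹ * (z - z₀) := by
    intro z
    have h1 := hab z
    rw [ha, zero_mul, zero_add] at h1
    have h2 := sub_smul_dslope h z₀ z
    rw [hz₀, sub_zero, smul_eq_mul] at h2
    rw [← h2, ← h1, inv_inv, mul_comm]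
  -- `τ z = p * conj z + q`
  obtain ⟨p, q, hpq⟩ : ∃ p q : ℂ, ∀ z, τ z = p * conj z + q :=
    ⟨conj b⁻¹, - conj b⁻¹ * conj z₀, fun z ↦ by rw [hτh, hform, map_mul, map_sub]; ring⟩
  have hq : p * conj q + q = 0 := by
    have := hinv 0
    rwa [hpq 0, map_zero, mul_zero, zero_add, hpq] at this
  have hp : p * conj p = 1 := by
    have h1 := hinv 1
    rw [hpq 1, hpq] at h1
    simp only [map_one, mul_one, map_add, mul_add] at h1
    linear_combination h1 - hq
  -- The mirror has direction `α = √p`, as `|p| = 1` gives `p * conj α = α`, and passes through `q /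
  -- 2`, the midpoint of `0` and `τ 0 = q`.
  obtain ⟨α, hα⟩ : ∃ α : ℂ, α ^ 2 = p := IsAlgClosed.exists_pow_nat_eq p two_pos
  have hα0 : α ≠ 0 := by
    rintro rfl
    rw [← hα] at hp
    simp at hp
  have hαn : α * conj α = 1 := by
    have h1 : (α * conj α) ^ 2 = 1 := by rw [mul_pow, ← map_pow, hα, hp]
    rw [Complex.mul_conj] at h1 ⊢
    have h2 : Complex.normSq α ^ 2 = 1 := by exact_mod_cast h1
    have h3 : Complex.normSq α = 1 := by nlinarith [Complex.normSq_nonneg α]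
    rw [h3]; norm_num
  refine ⟨α, q / 2, hα0, fun w ↦ ?_⟩
  rw [hpq]
  simp only [map_add, map_mul, map_div₀, map_ofNat]
  linear_combination (1 / 2) * hq + (α * conj w) * hαn - conj α * conj w * hα

theorem fixed_iff_of_line {τ : ℂ → ℂ} {α β : ℂ} (hα : α ≠ 0)
    (h : ∀ w, τ (β + α * w) = β + α * conj w) (z : ℂ) :
    τ z = z ↔ ∃ t : ℝ, z = β + α * t := by
  constructor
  · intro hz
    have hw : z = β + α * ((z - β) / α) := by field_simp; ring
    rw [hw, h] at hz
    have := mul_left_cancel₀ hα (add_left_cancel hz)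
    obtain ⟨t, ht⟩ := Complex.conj_eq_iff_real.mp this
    exact ⟨t, by rw [← ht]; exact hw⟩
  · rintro ⟨t, rfl⟩
    rw [h, Complex.conj_ofReal]

end Involutions

/-! ### Polynomials dominated on a line. -/

section Line

/-- If all roots of `r` lie on a real line and `|s| ≤ |r|` on this line, then `s` is proportional to
`r`. -/
theorem exists_eq_C_mul_of_norm_le_on_line {α β : ℂ} (hα : α ≠ 0) {r : ℂ[X]} (hr : r ≠ 0)
    (hroots : ∀ z, r.IsRoot z → ∃ t : ℝ, z = β + α * t) {s : ℂ[X]}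
    (hle : ∀ t : ℝ, ‖s.eval (β + α * t)‖ ≤ ‖r.eval (β + α * t)‖) : ∃ c : ℂ, s = C c * r := by
  induction hd : r.natDegree generalizing r s with
  | zero =>
    obtain ⟨c, rfl⟩ := natDegree_eq_zero.mp hd
    have hc : c ≠ 0 := by simpa using hr
    have hs : ¬ 0 < s.degree := by
      -- A non-constant polynomial is unbounded on the line, whereas `s` is bounded by the constant
      -- `|c|`.
      intro hs
      have hz : Filter.Tendsto (fun t : ℝ ↦ ‖β + α * (t : ℂ)‖) Filter.atTop Filter.atTop := by
        have h1 : Filter.Tendsto (fun t : ℝ ↦ ‖α‖ * t - ‖β‖) Filter.atTop Filter.atTop :=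
          Filter.tendsto_atTop_add_const_right _ _ (Filter.tendsto_id.const_mul_atTop (norm_pos_iff.mpr hα))
        refine Filter.tendsto_atTop_mono (fun t ↦ ?_) h1
        have h2 : ‖α * (t : ℂ)‖ - ‖β‖ ≤ ‖β + α * (t : ℂ)‖ := by
          have := norm_sub_norm_le (α * (t : ℂ)) (-β)
          rwa [norm_neg, sub_neg_eq_add, add_comm] at this
        refine le_trans ?_ h2
        rw [norm_mul, Complex.norm_real, Real.norm_eq_abs]
        gcongr
        exact le_abs_self t
      have h3 := tendsto_norm_atTop s hs hz
      obtain ⟨t, ht⟩ := (h3.eventually (Filter.eventually_gt_atTop ‖c‖)).exists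
      have := hle t
      rw [eval_C] at this
      linarith
    obtain ⟨b, rfl⟩ : ∃ b, s = C b := ⟨_, eq_C_of_degree_le_zero (not_lt.mp hs)⟩
    exact ⟨b / c, by rw [← C_mul, div_mul_cancel₀ _ hc]⟩
  | succ k ih =>
    obtain ⟨a, ha⟩ := IsAlgClosed.exists_root r (by
      rw [degree_eq_natDegree hr, hd]; exact_mod_cast Nat.succ_ne_zero k)
    obtain ⟨t₀, rfl⟩ := hroots a ha
    -- The bound forces `s` to vanish at the root of `r`. After cancelling the common linear factor
    -- the inequality holds off `t₀`, and at `t₀` by continuity.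
    have hsa : s.IsRoot (β + α * t₀) := by
      have := hle t₀
      rw [ha.eq_zero, norm_zero] at this
      exact norm_le_zero_iff.mp this
    obtain ⟨r₁, rfl⟩ := dvd_iff_isRoot.mpr ha
    obtain ⟨s₁, rfl⟩ := dvd_iff_isRoot.mpr hsa
    have hr₁ : r₁ ≠ 0 := right_ne_zero_of_mul hr
    have hdense : Dense ({t₀}ᶜ : Set ℝ) := dense_compl_singleton t₀
    have hle₁ : ∀ t : ℝ, ‖s₁.eval (β + α * t)‖ ≤ ‖r₁.eval (β + α * t)‖ := by
      have hclosed : IsClosed {t : ℝ | ‖s₁.eval (β + α * t)‖ ≤ ‖r₁.eval (β + α * t)‖} :=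
        isClosed_le (by fun_prop) (by fun_prop)
      have hsub : ({t₀}ᶜ : Set ℝ) ⊆ {t : ℝ | ‖s₁.eval (β + α * t)‖ ≤ ‖r₁.eval (β + α * t)‖} := by
        intro t ht
        have h1 := hle t
        rw [eval_mul, eval_mul, norm_mul, norm_mul] at h1
        refine le_of_mul_le_mul_left h1 (norm_pos_iff.mpr ?_)
        have : (t : ℂ) - t₀ ≠ 0 := by
          rw [sub_ne_zero]; exact_mod_cast ht
        simp only [eval_sub, eval_X, eval_C]
        rw [show β + α * (t : ℂ) - (β + α * t₀) = α * (t - t₀) by ring]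
        exact mul_ne_zero hα this
      intro t
      exact hclosed.closure_subset_iff.mpr hsub (hdense t)
    obtain ⟨c, hc⟩ := ih hr₁ (fun z hz ↦ hroots z (by
      rw [IsRoot.def, eval_mul, hz.eq_zero, mul_zero])) hle₁ (by
      rw [natDegree_mul (X_sub_C_ne_zero _) hr₁, natDegree_X_sub_C] at hd
      lia)
    exact ⟨c, by rw [hc]; ring⟩

end Line

/-! ### Weighted leading forms, i.e. points of the curve over `λ = ∞`. -/

section LeadingForm

/-- The substitution `λ = T`, `μ = s T^m`; the result is a polynomial in `T` with coefficients in
`ℂ[s]`. -/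
def weightHom (m : ℕ) : ℂ[X][X] →+* ℂ[X][X] := eval₂RingHom (mapRingHom C) (C X * X ^ m)

/-- The monomial `λ^k μ^i` becomes `s^i T^(k + m i)`, so distinct monomials never merge. -/
theorem weightHom_coeff_coeff (m : ℕ) (p : ℂ[X][X]) (i j : ℕ) :
    ((weightHom m p).coeff j).coeff i =
      if m * i ≤ j then (p.coeff i).coeff (j - m * i) else 0 := by
  induction p using Polynomial.induction_on' with
  | add p q hp hq =>
    rw [map_add, coeff_add, coeff_add, hp, hq, coeff_add, coeff_add]
    split_ifs <;> simp
  | monomial k a =>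
    have : weightHom m (monomial k a) = a.map C * C (X ^ k) * X ^ (m * k) := by
      simp [weightHom, eval₂_monomial, mul_pow, pow_mul, mul_assoc]
    rw [this, coeff_mul_X_pow']
    rcases eq_or_ne k i with rfl | hki
    · rw [coeff_monomial, if_pos rfl]
      split_ifs with h
      · rw [coeff_mul_C, coeff_map, coeff_C_mul, coeff_X_pow_self, mul_one]
      · simp
    · rw [coeff_monomial, if_neg hki, coeff_zero, ite_self]
      split_ifs with h
      · rw [coeff_mul_C, coeff_map, coeff_C_mul, coeff_X_pow, if_neg (Ne.symm hki), mul_zero]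
      · simp

/-- The leading form of a polynomial with respect to the weights `1` for `λ` and `m` for `μ`,
restricted to `λ = 1`. -/
def leadingForm (m : ℕ) (p : ℂ[X][X]) : ℂ[X] := (weightHom m p).leadingCoeff

theorem leadingForm_mul (m : ℕ) (p q : ℂ[X][X]) :
    leadingForm m (p * q) = leadingForm m p * leadingForm m q := by
  simp [leadingForm]

theorem le_natDegree_weightHom (m : ℕ) {f : ℂ[X][X]} (hf : f.Monic) :
    m * f.natDegree ≤ (weightHom m f).natDegree := by
  refine le_natDegree_of_ne_zero fun h ↦ ?_
  have := weightHom_coeff_coeff m f f.natDegree (m * f.natDegree)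
  rw [h, if_pos le_rfl, coeff_natDegree, hf.leadingCoeff] at this
  simp at this

theorem weightHom_ne_zero (m : ℕ) {f : ℂ[X][X]} (hf : f.Monic) : weightHom m f ≠ 0 := by
  intro h
  have := weightHom_coeff_coeff m f f.natDegree (m * f.natDegree)
  rw [h, if_pos le_rfl, coeff_natDegree, hf.leadingCoeff] at this
  simp at this

/-- A polynomial that is monic in `μ`, such that `μ^k` is part of its leading form. -/
structure IsWeightedMonic (m : ℕ) (f : ℂ[X][X]) : Prop where
  monic : f.Monic
  natDegree_weightHom : (weightHom m f).natDegree = m * f.natDegree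

variable {m : ℕ} {f g : ℂ[X][X]}

/-- The weighted degree is additive and at least `m` times the `μ`-degree for each monic factor;
equality for the product forces equality for both. -/
theorem IsWeightedMonic.of_mul (hf : f.Monic) (hg : g.Monic) (h : IsWeightedMonic m (f * g)) :
    IsWeightedMonic m f ∧ IsWeightedMonic m g := by
  have h1 := h.natDegree_weightHom
  rw [map_mul, natDegree_mul (weightHom_ne_zero m hf) (weightHom_ne_zero m hg), hf.natDegree_mul hg,
    mul_add] at h1
  have h2 := le_natDegree_weightHom m hf
  have h3 := le_natDegree_weightHom m hg
  exact ⟨⟨hf, by lia⟩, ⟨hg, by lia⟩⟩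

theorem IsWeightedMonic.coeff_leadingForm (h : IsWeightedMonic m f) {i : ℕ}
    (hi : i ≤ f.natDegree) :
    (leadingForm m f).coeff i = (f.coeff i).coeff (m * (f.natDegree - i)) := by
  rw [leadingForm, leadingCoeff, h.natDegree_weightHom, weightHom_coeff_coeff,
    if_pos (Nat.mul_le_mul_left m hi), ← Nat.mul_sub]

theorem IsWeightedMonic.natDegree_coeff_le (h : IsWeightedMonic m f) {i : ℕ}
    (hi : i ≤ f.natDegree) : (f.coeff i).natDegree ≤ m * (f.natDegree - i) := by
  rw [natDegree_le_iff_coeff_eq_zero]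
  intro j hj
  have := weightHom_coeff_coeff m f i (j + m * i)
  rw [if_pos (Nat.le_add_left _ _), Nat.add_sub_cancel] at this
  have h0 : (weightHom m f).coeff (j + m * i) = 0 := by
    refine coeff_eq_zero_of_natDegree_lt ?_
    rw [h.natDegree_weightHom]
    rw [Nat.mul_sub] at hj
    have := Nat.mul_le_mul_left m hi
    lia
  rw [← this, h0, coeff_zero]

theorem natDegree_leadingForm_le (m : ℕ) (f : ℂ[X][X]) :
    (leadingForm m f).natDegree ≤ f.natDegree := by
  rw [natDegree_le_iff_coeff_eq_zero]
  intro i hi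
  rw [leadingForm, leadingCoeff, weightHom_coeff_coeff, coeff_eq_zero_of_natDegree_lt hi,
    coeff_zero, ite_self]

theorem IsWeightedMonic.monic_leadingForm (h : IsWeightedMonic m f) : (leadingForm m f).Monic := by
  refine monic_of_natDegree_le_of_coeff_eq_one _ (natDegree_leadingForm_le m f) ?_
  rw [h.coeff_leadingForm le_rfl, coeff_natDegree, h.monic.leadingCoeff]
  simp

theorem IsWeightedMonic.natDegree_leadingForm (h : IsWeightedMonic m f) :
    (leadingForm m f).natDegree = f.natDegree := by
  refine le_antisymm (natDegree_leadingForm_le m f) (le_natDegree_of_ne_zero ?_)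
  rw [h.coeff_leadingForm le_rfl, coeff_natDegree, h.monic.leadingCoeff]
  simp

end LeadingForm

/-! ### The spectral polynomial and its leading form. -/

section SpectralPoly

variable {n m : ℕ}

theorem spectralPoly_eq (L : MatPoly n m) :
    spectralPoly L = (-1) ^ n * L.toPolyMatrix.charpoly := by
  rw [spectralPoly, Matrix.charpoly, ← neg_sub, Matrix.det_neg, Fintype.card_fin]
  congr 2
  rw [Matrix.charmatrix, Matrix.smul_one_eq_diagonal]
  rfl

theorem charpoly_eval_eval (L : MatPoly n m) (z μ : ℂ) :
    (spectralPoly L).evalEval z μ = spectralValues L (z, μ) := by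
  rw [spectralPoly, ← coe_evalEvalRingHom, RingHom.map_det, spectralValues, ← L.map_eval_toPolyMatrix]
  congr 1
  ext i j
  rcases eq_or_ne i j with rfl | hij
  · simp
  · simp [hij]

theorem spectralPoly_eq_of_spectralValues_eq {L L₀ : MatPoly n m}
    (h : spectralValues L = spectralValues L₀) : spectralPoly L = spectralPoly L₀ := by
  have hz : ∀ z, (spectralPoly L).map (evalRingHom z) = (spectralPoly L₀).map (evalRingHom z) := by
    intro z
    refine Polynomial.funext fun μ ↦ ?_
    have := charpoly_eval_eval L z μ
    rw [h, ← charpoly_eval_eval L₀] at this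
    rwa [← map_evalRingHom_eval, ← map_evalRingHom_eval] at this
  ext1 i
  refine Polynomial.funext fun z ↦ ?_
  simpa using congrArg (fun p ↦ p.coeff i) (hz z)

theorem MatPoly.natDegree_toPolyMatrix_le (L : MatPoly n m) (i j : Fin n) :
    (L.toPolyMatrix i j).natDegree ≤ m := by
  rw [toPolyMatrix_apply]
  refine natDegree_sum_le_of_forall_le _ _ fun k _ ↦ ?_
  rw [mul_comm]
  exact (natDegree_C_mul_X_pow_le _ _).trans (Nat.lt_succ_iff.mp k.2)

theorem MatPoly.coeff_toPolyMatrix (L : MatPoly n m) (i j : Fin n) (k : Fin (m + 1)) :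
    (L.toPolyMatrix i j).coeff k = L k i j := by
  rw [toPolyMatrix_apply, finsetSum_coeff, Finset.sum_eq_single k]
  · rw [mul_comm, coeff_C_mul, coeff_X_pow_self, mul_one]
  · intro b _ hb
    rw [mul_comm, coeff_C_mul, coeff_X_pow, if_neg, mul_zero]
    exact fun h ↦ hb (Fin.ext h.symm)
  · simp

/-- After the substitution each entry of the characteristic matrix has `T`-degree at most `m`, and
its `T^m`-coefficients form the characteristic matrix of `B_m`. Hence the points at infinity of the
curve correspond to the eigenvalues of `B_m`. -/
theorem isWeightedMonic_charpoly (L : MatPoly n m) :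
    IsWeightedMonic m L.toPolyMatrix.charpoly ∧
      leadingForm m L.toPolyMatrix.charpoly = (L.coeff (Fin.last m)).charpoly := by
  set χ := L.toPolyMatrix.charpoly with hχ
  have hmonic : χ.Monic := L.toPolyMatrix.charpoly_monic
  have hdeg : χ.natDegree = n := by
    rw [hχ, Matrix.charpoly_natDegree_eq_dim, Fintype.card_fin]
  set W : Matrix (Fin n) (Fin n) ℂ[X][X] := L.toPolyMatrix.charmatrix.map (weightHom m) with hW
  have hdet : weightHom m χ = W.det := by
    rw [hχ, Matrix.charpoly, RingHom.map_det]; rfl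
  have hWij : ∀ i j, W i j = (if i = j then C X * X ^ m else 0) - (L.toPolyMatrix i j).map C := by
    intro i j
    rw [hW, Matrix.map_apply]
    rcases eq_or_ne i j with rfl | hij
    · simp [Matrix.charmatrix_apply_eq, weightHom]
    · simp [weightHom, hij]
  have hWdeg : ∀ i j, (W i j).natDegree ≤ m := by
    intro i j
    rw [hWij]
    have h1 : ((L.toPolyMatrix i j).map (C : ℂ →+* ℂ[X])).natDegree ≤ m :=
      le_trans natDegree_map_le (L.natDegree_toPolyMatrix_le i j)
    refine (natDegree_sub_le _ _).trans (max_le ?_ h1)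
    split_ifs
    · exact natDegree_C_mul_X_pow_le _ _
    · simp
  have hWcoeff : ∀ i j, (W i j).coeff m = (L.coeff (Fin.last m)).charmatrix i j := by
    intro i j
    have := L.coeff_toPolyMatrix i j (Fin.last m)
    rw [Fin.val_last] at this
    rw [hWij, coeff_sub, coeff_map, this]
    rcases eq_or_ne i j with rfl | hij
    · simp [Matrix.charmatrix_apply_eq, MatPoly.coeff]
    · simp [hij, MatPoly.coeff]
  have hle : W.det.natDegree ≤ m * n := by
    rw [Matrix.det_apply']
    refine natDegree_sum_le_of_forall_le _ _ fun σ _ ↦ ?_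
    refine natDegree_mul_le.trans ?_
    rw [natDegree_intCast, zero_add]
    refine (natDegree_prod_le _ _).trans ?_
    refine (Finset.sum_le_card_nsmul _ _ m fun i _ ↦ hWdeg _ _).trans ?_
    simp [mul_comm]
  have hcoeff : W.det.coeff (m * n) = (L.coeff (Fin.last m)).charpoly := by
    rw [Matrix.det_apply', finsetSum_coeff, Matrix.charpoly, Matrix.det_apply']
    refine Finset.sum_congr rfl fun σ _ ↦ ?_
    rw [coeff_intCast_mul]
    congr 1
    have := coeff_prod_of_natDegree_le Finset.univ (fun i ↦ W (σ i) i) m (fun i _ ↦ hWdeg _ _)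
    rw [Finset.card_univ, Fintype.card_fin, mul_comm] at this
    rw [this]
    exact Finset.prod_congr rfl fun i _ ↦ hWcoeff _ _
  have hnat : (weightHom m χ).natDegree = m * χ.natDegree :=
    le_antisymm (by rw [hdet, hdeg]; exact hle) (le_natDegree_weightHom m hmonic)
  refine ⟨⟨hmonic, hnat⟩, ?_⟩
  rw [leadingForm, leadingCoeff, hnat, hdeg, hdet, hcoeff]

end SpectralPoly

/-! ### Partial derivatives and Kähler differentials. -/

section PartialDerivative

/-- The derivative `∂p/∂λ`. -/
def derivativeInner (p : ℂ[X][X]) : ℂ[X][X] := p.sum fun i a ↦ monomial i (derivative a)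

theorem derivativeInner_add (p q : ℂ[X][X]) :
    derivativeInner (p + q) = derivativeInner p + derivativeInner q :=
  sum_add_index p q _ (by simp) (by simp)

theorem derivativeInner_monomial (i : ℕ) (a : ℂ[X]) :
    derivativeInner (monomial i a) = monomial i (derivative a) :=
  sum_monomial_index a _ (by simp)

theorem evalEval_derivativeInner (p : ℂ[X][X]) (a b : ℂ) :
    (derivativeInner p).evalEval a b = (derivative (p.eval (C b))).eval a := by
  induction p using Polynomial.induction_on' with
  | add p q hp hq => simp [derivativeInner_add, hp, hq]
  | monomial i c =>
    rw [derivativeInner_monomial, eval_monomial, ← C_pow, derivative_mul, derivative_C, mul_zero,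
      add_zero, eval_mul, eval_C, evalEval, eval_monomial, ← C_pow, eval_mul, eval_C]

theorem evalEval_derivative (p : ℂ[X][X]) (a b : ℂ) :
    (derivative p).evalEval a b = (derivative (p.map (evalRingHom a))).eval b := by
  rw [derivative_map, map_evalRingHom_eval]

section

variable {F : Type*} [Field F] [Algebra ℂ F] (ev : ℂ[X][X] →ₐ[ℂ] F)

theorem apply_C_eq_aeval (q : ℂ[X]) : ev (C q) = aeval (ev (C X)) q := by
  have : (ev.comp (CAlgHom (R := ℂ) (A := ℂ[X]))) = aeval (ev (C X)) := by
    ext; simp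
  exact congrArg (fun φ : ℂ[X] →ₐ[ℂ] F ↦ φ q) this

theorem apply_eq_sum_range {p : ℂ[X][X]} {N : ℕ} (hp : p.natDegree < N) :
    ev p = ∑ i ∈ Finset.range N, ev (C (p.coeff i)) * ev X ^ i := by
  have h1 := hom_eval₂ p C (ev : ℂ[X][X] →+* F) X
  rw [eval₂_C_X, eval₂_eq_sum_range' _ hp] at h1
  exact h1

/-- The chain rule. -/
theorem D_apply_eq (p : ℂ[X][X]) :
    KaehlerDifferential.D ℂ F (ev p) =
      ev (derivativeInner p) • KaehlerDifferential.D ℂ F (ev (C X)) +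
        ev (derivative p) • KaehlerDifferential.D ℂ F (ev X) := by
  induction p using Polynomial.induction_on' with
  | add p q hp hq =>
    simp only [map_add, derivativeInner_add, hp, hq, add_smul]
    abel
  | monomial i a =>
    have hC : KaehlerDifferential.D ℂ F (ev (C a)) =
        ev (C (derivative a)) • KaehlerDifferential.D ℂ F (ev (C X)) := by
      rw [apply_C_eq_aeval ev a, apply_C_eq_aeval ev (derivative a), Derivation.map_aeval]
    rw [derivativeInner_monomial, ← C_mul_X_pow_eq_monomial, ← C_mul_X_pow_eq_monomial, map_mul,
      map_pow, Derivation.leibniz, Derivation.leibniz_pow, hC, derivative_C_mul_X_pow]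
    rw [add_comm, ← Nat.cast_smul_eq_nsmul F]
    simp only [map_mul, map_pow, smul_smul, map_natCast]
    congr 2 <;> ring

end

end PartialDerivative

/-! ### The Nullstellensatz in the plane and smooth curves. -/

section Nullstellensatz

/-- The residue field is of finite type over `ℂ`, hence finite, hence `ℂ` itself; the classes of `λ`
and `μ` are the coordinates. -/
theorem exists_evalEval_eq_zero_of_isMaximal {I : Ideal ℂ[X][X]} (hI : I.IsMaximal) :
    ∃ a b : ℂ, ∀ p ∈ I, p.evalEval a b = 0 := by
  let K := ℂ[X][X] ⧸ I
  let _ : Field K := Ideal.Quotient.field I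
  have : Algebra.FiniteType ℂ ℂ[X][X] := Algebra.FiniteType.trans (S := ℂ[X]) inferInstance inferInstance
  have : Algebra.FiniteType ℂ K := Algebra.FiniteType.trans (S := ℂ[X][X]) this inferInstance
  have : Module.Finite ℂ K := finite_of_finite_type_of_isJacobsonRing ℂ K
  have hbij := IsAlgClosed.algebraMap_bijective_of_isIntegral (k := ℂ) (K := K)
  obtain ⟨a, ha⟩ := hbij.2 (Ideal.Quotient.mk I (C X))
  obtain ⟨b, hb⟩ := hbij.2 (Ideal.Quotient.mk I X)
  refine ⟨a, b, fun p hp ↦ hbij.1 ?_⟩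
  have : (algebraMap ℂ K).comp (evalEvalRingHom a b) = Ideal.Quotient.mk I := by
    refine Polynomial.ringHom_ext' (Polynomial.ringHom_ext' ?_ ?_) ?_
    · ext c; simp; rfl
    · simpa using ha
    · simpa using hb
  rw [map_zero, ← Ideal.Quotient.eq_zero_iff_mem.mpr hp, ← this]
  rfl

/-- Otherwise the three polynomials lie in a maximal ideal, whose point would be singular. -/
theorem IsSmoothCurve.exists_bezout {f : ℂ[X][X]} (hf : IsSmoothCurve f) :
    ∃ u w q : ℂ[X][X], u * derivativeInner f + w * derivative f + q * f = 1 := by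
  have : Ideal.span {derivativeInner f, derivative f, f} = ⊤ := by
    by_contra h
    obtain ⟨I, hI, hle⟩ := Ideal.exists_le_maximal _ h
    obtain ⟨a, b, hab⟩ := exists_evalEval_eq_zero_of_isMaximal hI
    have hmem : ∀ p ∈ ({derivativeInner f, derivative f, f} : Set ℂ[X][X]), p.evalEval a b = 0 :=
      fun p hp ↦ hab p (hle (Ideal.subset_span hp))
    refine hf a b ⟨hmem f (by simp), ?_, ?_⟩
    · rw [← evalEval_derivativeInner]; exact hmem _ (by simp)
    · rw [← evalEval_derivative]; exact hmem _ (by simp)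
  have h1 : (1 : ℂ[X][X]) ∈ Ideal.span {derivativeInner f, derivative f, f} := this ▸ Submodule.mem_top
  rw [Ideal.mem_span_insert] at h1
  obtain ⟨u, z, hz, h1⟩ := h1
  obtain ⟨w, q, hz⟩ := Ideal.mem_span_pair.mp hz
  exact ⟨u, w, q, by rw [h1, ← hz]; ring⟩

end Nullstellensatz

/-! ### Regularity of `dλ / (∂f/∂μ)` at all places. -/

section Places

theorem mem_valuationSubring_of_isRoot {F : Type*} [Field F] (V : ValuationSubring F) {p : V[X]} (hp : p.Monic) {x : F}
    (hx : eval₂ (algebraMap V F) x p = 0) : x ∈ V := by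
  obtain ⟨y, rfl⟩ := IsIntegrallyClosed.isIntegral_iff (R := V) (K := F).mp ⟨p, hp, hx⟩
  exact y.2

variable {F : Type*} [Field F] [Algebra ℂ F] (ev : ℂ[X][X] →ₐ[ℂ] F) {f : ℂ[X][X]}

theorem apply_C_mem_of_mem (V : ValuationSubring F) (hV : ∀ c : ℂ, algebraMap ℂ F c ∈ V)
    (hX : ev (C X) ∈ V) (a : ℂ[X]) : ev (C a) ∈ V := by
  induction a using Polynomial.induction_on' with
  | add p q hp hq => rw [C_add, map_add]; exact add_mem hp hq
  | monomial j c =>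
    rw [← C_mul_X_pow_eq_monomial, C_mul, C_pow, map_mul, map_pow]
    refine mul_mem ?_ (pow_mem hX j)
    have : ev (C (C c)) = algebraMap ℂ F c := ev.commutes c
    rw [this]; exact hV c

theorem apply_mem_of_mem (V : ValuationSubring F) (hV : ∀ c : ℂ, algebraMap ℂ F c ∈ V)
    (hX : ev (C X) ∈ V) (hY : ev X ∈ V) (p : ℂ[X][X]) : ev p ∈ V := by
  induction p using Polynomial.induction_on' with
  | add p q hp hq => rw [map_add]; exact add_mem hp hq
  | monomial i a =>
    rw [← C_mul_X_pow_eq_monomial, map_mul, map_pow]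
    exact mul_mem (apply_C_mem_of_mem ev V hV hX a) (pow_mem hY i)

/-- The differential `dλ / (∂f/∂μ)` is regular at the places over finite `λ`. -/
theorem mem_span_of_finite (hmonic : f.Monic) (hev : ev f = 0) (hsmooth : IsSmoothCurve f)
    (hf' : ev (derivative f) ≠ 0) (V : ValuationSubring F) (hV : ∀ c : ℂ, algebraMap ℂ F c ∈ V)
    (hX : ev (C X) ∈ V) :
    (ev (derivative f))⁻¹ • KaehlerDifferential.D ℂ F (ev (C X)) ∈
      Submodule.span ℂ {η | ∃ a ∈ V, ∃ b ∈ V, η = a • KaehlerDifferential.D ℂ F b} := by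
  let φ : ℂ[X] →+* V := ((ev : ℂ[X][X] →+* F).comp C).codRestrict V.toSubring
    (apply_C_mem_of_mem ev V hV hX)
  have hY : ev X ∈ V := by
    refine mem_valuationSubring_of_isRoot V (hmonic.map φ) ?_
    rw [eval₂_map]
    have h1 : (algebraMap V F).comp φ = (ev : ℂ[X][X] →+* F).comp C := rfl
    rw [h1, ← hev]
    have := hom_eval₂ f C (ev : ℂ[X][X] →+* F) X
    rw [eval₂_C_X] at this
    exact this.symm
  have hall := apply_mem_of_mem ev V hV hX hY
  -- On the curve `u f_λ + w f_μ = 1` and `f_λ dλ + f_μ dμ = 0`, so `dλ / f_μ = w dλ - u dμ`, with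
  -- `λ`, `μ`, `u`, `w` all in `V`.
  obtain ⟨u, w, q, huw⟩ := hsmooth.exists_bezout
  have h1 : ev u * ev (derivativeInner f) + ev w * ev (derivative f) = 1 := by
    have := congrArg ev huw
    rwa [map_add, map_mul _ q, hev, mul_zero, add_zero, map_add, map_mul, map_mul, map_one] at this
  have h2 := D_apply_eq ev f
  rw [hev, map_zero] at h2
  have h3 : (ev (derivative f))⁻¹ • KaehlerDifferential.D ℂ F (ev (C X)) =
      ev w • KaehlerDifferential.D ℂ F (ev (C X)) + (-ev u) • KaehlerDifferential.D ℂ F (ev X) := by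
    have h4 : KaehlerDifferential.D ℂ F (ev X) =
        -((ev (derivative f))⁻¹ * ev (derivativeInner f)) • KaehlerDifferential.D ℂ F (ev (C X)) := by
      have h5 : ev (derivative f) • KaehlerDifferential.D ℂ F (ev X) =
        -(ev (derivativeInner f)) • KaehlerDifferential.D ℂ F (ev (C X)) := by
        rw [neg_smul]; exact (neg_eq_of_add_eq_zero_right h2.symm).symm
      rw [← mul_neg, mul_smul, ← h5, smul_smul, inv_mul_cancel₀ hf', one_smul]
    rw [h4, smul_smul, ← add_smul]
    congr 1
    field_simp
    linear_combination -h1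
  rw [h3]
  exact add_mem (Submodule.subset_span ⟨_, hall w, _, hX, rfl⟩)
    (Submodule.subset_span ⟨_, neg_mem (hall u), _, hY, rfl⟩)

/-- The differential `dλ / (∂f/∂μ)` is regular at the places over `λ = ∞`. -/
theorem mem_span_of_infinite {m : ℕ} (hw : IsWeightedMonic m f) (hev : ev f = 0)
    (hsep : (leadingForm m f).Separable) (hm : 2 ≤ m * (f.natDegree - 1))
    (V : ValuationSubring F) (hV : ∀ c : ℂ, algebraMap ℂ F c ∈ V) (hX : ev (C X) ∉ V) :
    (ev (derivative f))⁻¹ • KaehlerDifferential.D ℂ F (ev (C X)) ∈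
      Submodule.span ℂ {η | ∃ a ∈ V, ∃ b ∈ V, η = a • KaehlerDifferential.D ℂ F b} := by
  set k := f.natDegree with hk
  have hX0 : ev (C X) ≠ 0 := fun h ↦ hX (h ▸ zero_mem V)
  let c : ℂ →+* V := (algebraMap ℂ F).codRestrict V.toSubring hV
  have htV : (ev (C X))⁻¹ ∈ V := (V.mem_or_inv_mem _).resolve_left hX
  let t : V := ⟨(ev (C X))⁻¹, htV⟩
  have htF : ((t : V) : F) = (ev (C X))⁻¹ := rfl
  -- the equation of the curve near infinity, in the coordinates `t = λ⁻¹`, `s = μ λ⁻ᵐ`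
  let g : V[X] := ∑ i ∈ Finset.range (k + 1),
    monomial i (eval₂ c t (reflect (m * (k - i)) (f.coeff i)))
  have hgcoeff : ∀ i ≤ k, g.coeff i = eval₂ c t (reflect (m * (k - i)) (f.coeff i)) := by
    intro i hi
    simp only [g, finsetSum_coeff, coeff_monomial]
    rw [Finset.sum_ite_eq' (Finset.range (k + 1)) i, if_pos (Finset.mem_range.mpr (Nat.lt_succ_of_le hi))]
  have hgdeg : g.natDegree ≤ k := by
    refine natDegree_sum_le_of_forall_le _ _ fun i hi ↦ (natDegree_monomial_le _).trans ?_
    exact Nat.lt_succ_iff.mp (Finset.mem_range.mp hi)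
  have hgmonic : g.Monic := by
    refine monic_of_natDegree_le_of_coeff_eq_one k hgdeg ?_
    rw [hgcoeff k le_rfl, hk, coeff_natDegree, hw.monic.leadingCoeff]
    simp
  have hgF : ∀ i ≤ k, ((g.coeff i : V) : F) = (ev (C X))⁻¹ ^ (m * (k - i)) * ev (C (f.coeff i)) := by
    intro i hi
    let _ : Invertible (ev (C X)) := invertibleOfNonzero hX0
    have h1 := eval₂_reflect_mul_pow (algebraMap ℂ F) (ev (C X)) (m * (k - i)) (f.coeff i)
      (hw.natDegree_coeff_le hi)
    rw [invOf_eq_inv] at h1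
    have h2 : ((g.coeff i : V) : F) =
        eval₂ (algebraMap ℂ F) (ev (C X))⁻¹ (reflect (m * (k - i)) (f.coeff i)) := by
      rw [hgcoeff i hi]
      exact hom_eval₂ _ c V.subtype t
    rw [h2, apply_C_eq_aeval ev (f.coeff i), aeval_def, ← h1, inv_pow]
    field_simp
  set s : F := ev X * (ev (C X))⁻¹ ^ m with hs
  have hgs : eval₂ (algebraMap V F) s g = 0 := by
    have h1 : eval₂ (algebraMap V F) s g = (ev (C X))⁻¹ ^ (m * k) * ev f := by
      rw [eval₂_eq_sum_range' _ (Nat.lt_succ_of_le hgdeg),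
        apply_eq_sum_range ev (Nat.lt_succ_of_le hk.ge), Finset.mul_sum]
      refine Finset.sum_congr rfl fun i hi ↦ ?_
      have hi' : i ≤ k := Nat.lt_succ_iff.mp (Finset.mem_range.mp hi)
      change ((g.coeff i : V) : F) * s ^ i = _
      rw [hgF i hi', hs, mul_pow, ← pow_mul, show m * k = m * (k - i) + m * i by
        rw [← mul_add, Nat.sub_add_cancel hi'], pow_add]
      ring
    rw [h1, hev, mul_zero]
  have hsV : s ∈ V := mem_valuationSubring_of_isRoot V hgmonic hgs
  let s' : V := ⟨s, hsV⟩
  have hgs' : g.eval s' = 0 := by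
    apply Subtype.val_injective
    have := hom_eval₂ g (RingHom.id V) (algebraMap V F) s'
    exact this.trans hgs
  -- As `g(s) = t^(m k) f(μ)` with `μ = s t^(-m)`, differentiation in `s` costs a factor `t^(-m)`.
  have hder : (((derivative g).eval s' : V) : F) =
      (ev (C X))⁻¹ ^ (m * (k - 1)) * ev (derivative f) := by
    have hk1 : 1 ≤ k := by
      by_contra h0
      rw [show k - 1 = 0 by lia] at hm
      simp at hm
    have h1 : (((derivative g).eval s' : V) : F) = eval₂ (algebraMap V F) s (derivative g) :=
      hom_eval₂ (derivative g) (RingHom.id V) (algebraMap V F) s'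
    have h2 : (derivative g).natDegree < k := (natDegree_derivative_le g).trans_lt (by lia)
    have h3 : (derivative f).natDegree < k := (natDegree_derivative_le f).trans_lt (by lia)
    rw [h1, eval₂_eq_sum_range' _ h2, apply_eq_sum_range ev h3, Finset.mul_sum]
    refine Finset.sum_congr rfl fun i hi ↦ ?_
    have hi' : i + 1 ≤ k := Finset.mem_range.mp hi
    rw [coeff_derivative, coeff_derivative, map_mul, C_mul, map_mul]
    change ((g.coeff (i + 1) : V) : F) * _ * s ^ i = _
    rw [hgF (i + 1) hi', hs, mul_pow, ← pow_mul, show m * (k - 1) = m * (k - (i + 1)) + m * i by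
        rw [← mul_add]; congr 1; lia, pow_add]
    simp only [map_add, map_natCast, map_one]
    ring
  have ht0 : IsLocalRing.residue V t = 0 := by
    rw [IsLocalRing.residue_eq_zero_iff, IsLocalRing.mem_maximalIdeal, mem_nonunits_iff]
    intro hu
    obtain ⟨y, hy⟩ := hu.exists_right_inv
    have h1 : (ev (C X))⁻¹ * (y : F) = 1 := congrArg Subtype.val hy
    have h2 : (y : F) = ev (C X) := by field_simp at h1; exact h1
    exact hX (h2 ▸ y.2)
  have hmap : g.map (IsLocalRing.residue V) =
      (leadingForm m f).map ((IsLocalRing.residue V).comp c) := by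
    ext i
    rw [coeff_map, coeff_map]
    by_cases hi : i ≤ k
    · rw [hgcoeff i hi, hom_eval₂, ht0, eval₂_at_zero, coeff_reflect, revAt_le (Nat.zero_le _),
        hw.coeff_leadingForm hi, Nat.sub_zero]
    · push Not at hi
      rw [coeff_eq_zero_of_natDegree_lt (hgdeg.trans_lt hi), coeff_eq_zero_of_natDegree_lt
        ((natDegree_leadingForm_le m f).trans_lt hi), map_zero, map_zero]
  -- Modulo the maximal ideal `t` vanishes and `g` becomes the leading form. That form is separable,
  -- so its root `s` is simple.
  have hunit : IsUnit ((derivative g).eval s') := by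
    by_contra hu
    have h1 : IsLocalRing.residue V ((derivative g).eval s') = 0 := by
      rwa [IsLocalRing.residue_eq_zero_iff, IsLocalRing.mem_maximalIdeal, mem_nonunits_iff]
    have hsep' : (g.map (IsLocalRing.residue V)).Separable := hmap ▸ hsep.map
    obtain ⟨a, b, hab⟩ := hsep'
    have h2 := congrArg (eval (IsLocalRing.residue V s')) hab
    rw [eval_add, eval_mul, eval_mul, derivative_map, eval_map_apply, eval_map_apply, h1, hgs'] at h2
    simp at h2
  obtain ⟨y, hy⟩ := hunit.exists_right_inv
  have hy' : (((derivative g).eval s' : V) : F) * (y : F) = 1 := congrArg Subtype.val hy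
  have hcoef : (ev (derivative f))⁻¹ = (ev (C X))⁻¹ ^ (m * (k - 1)) * y := by
    rw [hder] at hy'
    rw [inv_eq_iff_eq_inv, ← one_div]
    refine eq_div_of_mul_eq ?_ (by rw [← hy']; ring)
    intro h0
    rw [mul_right_comm, h0, zero_mul] at hy'
    exact zero_ne_one hy'
  have hD : KaehlerDifferential.D ℂ F (ev (C X)) =
      -(ev (C X)) ^ 2 • KaehlerDifferential.D ℂ F (ev (C X))⁻¹ := by
    have := Derivation.leibniz_inv (KaehlerDifferential.D ℂ F) (ev (C X))⁻¹
    rwa [inv_inv] at this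
  rw [hcoef, hD, smul_smul]
  refine Submodule.subset_span ⟨_, ?_, _, htV, rfl⟩
  -- With `dλ = -λ² dt` the differential is `-t^(m (k - 1) - 2) y dt`; the exponent is non-negative
  -- exactly by `hm`.
  have hfin : (ev (C X))⁻¹ ^ (m * (k - 1)) * (y : F) * -(ev (C X)) ^ 2 =
      -((ev (C X))⁻¹ ^ (m * (k - 1) - 2) * y) := by
    obtain ⟨e, he⟩ := Nat.exists_eq_add_of_le hm
    rw [he, Nat.add_sub_cancel_left, pow_add]
    field_simp
  rw [hfin]
  exact neg_mem (mul_mem (pow_mem htV _) y.2)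

end Places

/-! ### Curves of positive genus. -/

section Genus

/-- `dλ ≠ 0` on a field that is algebraic over `ℂ(λ)`. -/
theorem D_algebraMap_X_ne_zero {F : Type*} [Field F] [Algebra ℂ F] [Algebra ℂ[X] F]
    [IsScalarTower ℂ ℂ[X] F] [FaithfulSMul ℂ[X] F] [Algebra.IsAlgebraic ℂ[X] F] :
    KaehlerDifferential.D ℂ F (algebraMap ℂ[X] F X) ≠ 0 := by
  let K := FractionRing ℂ[X]
  let _ : Algebra K F := FractionRing.liftAlgebra ℂ[X] F
  have : IsScalarTower ℂ[X] K F := FractionRing.isScalarTower_liftAlgebra ℂ[X] F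
  have : Algebra.IsAlgebraic K F := IsFractionRing.comap_isAlgebraic_iff (A := ℂ[X]) (K := K) (C := F) |>.mp inferInstance
  have : CharZero K := charZero_of_injective_algebraMap (FaithfulSMul.algebraMap_injective ℂ[X] K)
  -- In characteristic zero `F` is formally étale over `ℂ[λ]`, so its differentials are `F ⊗
  -- Ω(ℂ[λ])`, where `dλ` is a basis.
  have : Algebra.FormallyEtale K F := Algebra.FormallyEtale.of_isSeparable K F
  have : Algebra.FormallyEtale ℂ[X] K := Algebra.FormallyEtale.of_isLocalization (nonZeroDivisors ℂ[X])
  have : Algebra.FormallyEtale ℂ[X] F := Algebra.FormallyEtale.comp ℂ[X] K F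
  intro h0
  have h1 := KaehlerDifferential.tensorKaehlerEquivOfFormallyEtale_symm_D_algebraMap
    (R := ℂ) (S := ℂ[X]) (T := F) X
  rw [h0, map_zero] at h1
  have h2 := congrArg (TensorProduct.congr (LinearEquiv.refl ℂ[X] F)
    (KaehlerDifferential.polynomialEquiv ℂ) ≪≫ₗ TensorProduct.rid ℂ[X] F) h1
  simp at h2

/-- A smooth irreducible curve with `m (k - 1) ≥ 2`, where `k` is its degree in `μ`, that has `k`
distinct points at infinity is not rational. -/
theorem curveGenus_ne_zero {m : ℕ} {f : ℂ[X][X]} (hf : Irreducible f) (hw : IsWeightedMonic m f)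
    (hsep : (leadingForm m f).Separable) (hsmooth : IsSmoothCurve f)
    (hm : 2 ≤ m * (f.natDegree - 1)) : curveGenus f hf ≠ 0 := by
  have hdom : IsDomain (AdjoinRoot f) := AdjoinRoot.isDomain_of_prime hf.prime
  let F := FractionRing (AdjoinRoot f)
  let ev : ℂ[X][X] →ₐ[ℂ] F := (Algebra.algHom ℂ (AdjoinRoot f) F).comp (AdjoinRoot.mkₐ f |>.restrictScalars ℂ)
  have hev : ∀ p, ev p = algebraMap (AdjoinRoot f) F (AdjoinRoot.mk f p) := fun p ↦ rfl
  have hev0 : ev f = 0 := by rw [hev, AdjoinRoot.mk_self, map_zero]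
  have hk : 2 ≤ f.natDegree := by
    by_contra h
    rw [show f.natDegree - 1 = 0 by lia] at hm
    simp at hm
  have hf' : ev (derivative f) ≠ 0 := by
    rw [hev, Ne, map_eq_zero_iff _ (IsFractionRing.injective (AdjoinRoot f) F), AdjoinRoot.mk_eq_zero]
    intro hdvd
    have h0 : derivative f ≠ 0 := by
      intro h0
      have := derivative_eq_zero.mp h0
      lia
    have := natDegree_le_of_dvd hdvd h0
    have := natDegree_derivative_le f
    lia
  have hinj : Function.Injective (algebraMap ℂ[X] F) := by
    rw [IsScalarTower.algebraMap_eq ℂ[X] (AdjoinRoot f) F]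
    refine (IsFractionRing.injective (AdjoinRoot f) F).comp
      (AdjoinRoot.of.injective_of_degree_ne_zero ?_)
    rw [degree_eq_natDegree hw.monic.ne_zero]
    exact_mod_cast (by lia : f.natDegree ≠ 0)
  have : FaithfulSMul ℂ[X] F := (faithfulSMul_iff_algebraMap_injective ℂ[X] F).mpr hinj
  have : Module.Finite ℂ[X] (AdjoinRoot f) := hw.monic.finite_adjoinRoot
  have : Algebra.IsAlgebraic ℂ[X] F := by
    have : Algebra.IsAlgebraic (AdjoinRoot f) F := IsLocalization.isAlgebraic _ (nonZeroDivisors _)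
    exact Algebra.IsAlgebraic.trans ℂ[X] (AdjoinRoot f) F
  have hD : KaehlerDifferential.D ℂ F (ev (C X)) ≠ 0 := D_algebraMap_X_ne_zero
  intro h0
  have hbot : regularDifferentials F = ⊥ := Submodule.rank_eq_zero.mp h0
  have hmem : (ev (derivative f))⁻¹ • KaehlerDifferential.D ℂ F (ev (C X)) ∈ regularDifferentials F := by
    rw [regularDifferentials, Submodule.mem_iInf]
    intro V
    rw [Submodule.mem_iInf]
    intro hV
    by_cases hX : ev (C X) ∈ V
    · exact mem_span_of_finite ev hw.monic hev0 hsmooth hf' V hV hX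
    · exact mem_span_of_infinite ev hw hev0 hsep hm V hV hX
  rw [hbot, Submodule.mem_bot, smul_eq_zero] at hmem
  exact hmem.elim (inv_ne_zero hf') hD

end Genus

/-! ### Normal matrices proportional to idempotents. -/

section NormalMatrices

variable {n : ℕ}

theorem commute_aeval_of_commute {M N : Matrix (Fin n) (Fin n) ℂ} (h : Commute M N) (p : ℂ[X]) :
    Commute (aeval M p) N := by
  induction p using Polynomial.induction_on' with
  | add p q hp hq => rw [map_add]; exact hp.add_left hq
  | monomial k c =>
    rw [aeval_monomial]
    exact (Algebra.commute_algebraMap_left c N).mul_left (h.pow_left k)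

theorem commute_aeval_conjTranspose {M : Matrix (Fin n) (Fin n) ℂ} (h : Commute M Mᴴ) (p : ℂ[X]) :
    Commute (aeval M p) (aeval M p)ᴴ := by
  have h1 : Commute (aeval M p) Mᴴ := commute_aeval_of_commute h p
  have h2 : Commute M (aeval M p)ᴴ := by
    have := congrArg Matrix.conjTranspose h1.eq
    rwa [Matrix.conjTranspose_mul, Matrix.conjTranspose_mul, Matrix.conjTranspose_conjTranspose] at this
  exact commute_aeval_of_commute h2 p

open ComplexOrder in
/-- The entries of a normal matrix with `S² = r S` are bounded by `|r|`. -/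
theorem norm_apply_le_of_normal {S : Matrix (Fin n) (Fin n) ℂ} {r : ℂ} (hS : Commute S Sᴴ)
    (h : S * S = r • S) (i j : Fin n) : ‖S i j‖ ≤ ‖r‖ := by
  have hstar : Sᴴ * Sᴴ = star r • Sᴴ := by
    rw [← Matrix.conjTranspose_mul, h, Matrix.conjTranspose_smul]
  -- `S* S = conj r • S`
  have hD : star r • S = Sᴴ * S := by
    -- For `D = conj r • S - S* S`, normality and `S² = r S` give `D* D = 0`.
    rw [← sub_eq_zero, ← Matrix.conjTranspose_mul_self_eq_zero]
    have e1 : Sᴴ * (Sᴴ * S) = star r • (Sᴴ * S) := by rw [← mul_assoc, hstar, smul_mul_assoc]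
    have e2 : (Sᴴ * S) * S = r • (Sᴴ * S) := by rw [mul_assoc, h, mul_smul_comm]
    have e3 : (Sᴴ * S) * (Sᴴ * S) = (r * star r) • (Sᴴ * S) := by
      rw [mul_assoc, ← mul_assoc S, hS.eq, mul_assoc Sᴴ S S, h, mul_smul_comm, mul_smul_comm, e1, smul_smul]
    rw [Matrix.conjTranspose_sub, Matrix.conjTranspose_smul, Matrix.conjTranspose_mul,
      Matrix.conjTranspose_conjTranspose, star_star, sub_mul, mul_sub, mul_sub, smul_mul_assoc,
      smul_mul_assoc, mul_smul_comm, mul_smul_comm, e1, e2, e3]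
    simp only [smul_smul]
    rw [mul_comm (star r) r]
    abel
  -- The diagonal entry reads `∑ |S_lj|² = conj r * S_jj`. The term `l = j` gives `|S_jj| ≤ |r|`,
  -- and then each term is at most `|r|²`.
  have hjj := congrFun (congrFun hD j) j
  have hsum : (Sᴴ * S) j j = ∑ l, ((‖S l j‖ ^ 2 : ℝ) : ℂ) := by
    rw [Matrix.mul_apply]
    refine Finset.sum_congr rfl fun l _ ↦ ?_
    rw [Matrix.conjTranspose_apply, Complex.star_def, mul_comm, Complex.mul_conj, Complex.normSq_eq_norm_sq]
  have hnorm : ∑ l, ‖S l j‖ ^ 2 = ‖r‖ * ‖S j j‖ := by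
    rw [hsum, ← Complex.ofReal_sum] at hjj
    have := congrArg norm hjj
    rw [Complex.norm_of_nonneg (Finset.sum_nonneg fun _ _ ↦ by positivity), Matrix.smul_apply,
      smul_eq_mul, norm_mul, norm_star] at this
    exact this.symm
  have hle : ∀ l, ‖S l j‖ ^ 2 ≤ ‖r‖ * ‖S j j‖ := fun l ↦ by
    rw [← hnorm]
    exact Finset.single_le_sum (f := fun l ↦ ‖S l j‖ ^ 2) (fun _ _ ↦ by positivity) (Finset.mem_univ l)
  have hj : ‖S j j‖ ≤ ‖r‖ := by
    rcases eq_or_lt_of_le (norm_nonneg (S j j)) with h0 | h0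
    · rw [← h0]; exact norm_nonneg r
    · have := hle j
      nlinarith
  have h2 : ‖S i j‖ ^ 2 ≤ ‖r‖ ^ 2 := (hle i).trans (by nlinarith [norm_nonneg r])
  exact (sq_le_sq₀ (norm_nonneg _) (norm_nonneg _)).mp h2

end NormalMatrices

/-! ### Constancy of the spectral projectors. -/

section Projector

variable {n m : ℕ}

theorem map_eval_aeval (L : MatPoly n m) (p : ℂ[X][X]) (z : ℂ) :
    (aeval L.toPolyMatrix p).map (evalRingHom z) = aeval (L.eval z) (p.map (evalRingHom z)) := by
  have h : (algebraMap ℂ (Matrix (Fin n) (Fin n) ℂ)).comp (evalRingHom z) =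
      ((evalRingHom z).mapMatrix).comp (algebraMap ℂ[X] (Matrix (Fin n) (Fin n) ℂ[X])) := by
    refine RingHom.ext fun a ↦ ?_
    ext i j
    rcases eq_or_ne i j with rfl | hij
    · simp [Matrix.algebraMap_matrix_apply]
    · simp [Matrix.algebraMap_matrix_apply, hij]
  have := map_aeval_eq_aeval_map h p L.toPolyMatrix
  rw [← L.map_eval_toPolyMatrix]
  exact this

/-- If the spectral curve splits, with intersections of the two parts only over a real line on which
`L` is normal, then the corresponding spectral projector does not depend on `λ`. -/
theorem exists_projector (L : MatPoly n m) {α β : ℂ} (hα : α ≠ 0)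
    (hnormal : ∀ t : ℝ, Commute (L.eval (β + α * t)) (L.eval (β + α * t))ᴴ)
    {f g : ℂ[X][X]} (hf : f.Monic) (hg : g.Monic) (hf0 : f.natDegree ≠ 0)
    (hfg : f * g = L.toPolyMatrix.charpoly)
    (hline : ∀ z b, f.evalEval z b = 0 → g.evalEval z b = 0 → ∃ t : ℝ, z = β + α * t) :
    ∃ E : Matrix (Fin n) (Fin n) ℂ,
      E.map C * L.toPolyMatrix = L.toPolyMatrix * E.map C ∧
      aeval L.toPolyMatrix f * E.map C = 0 ∧
      aeval L.toPolyMatrix g * (1 - E.map C) = 0 := by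
  set N := L.toPolyMatrix with hN
  set r : ℂ[X] := resultant f g with hr
  obtain ⟨p, q, -, -, hpq⟩ := exists_mul_add_mul_eq_C_resultant f g le_rfl le_rfl (Or.inl hf0)
  have hreval : ∀ z, r.eval z = resultant (f.map (evalRingHom z)) (g.map (evalRingHom z)) := by
    intro z
    rw [hf.natDegree_map, hg.natDegree_map, resultant_map_map]
    rfl
  have hroots : ∀ z, r.IsRoot z → ∃ t : ℝ, z = β + α * t := by
    intro z hz
    rw [IsRoot.def, hreval, resultant_eq_zero_iff] at hz
    obtain ⟨b, hb⟩ : ∃ b, (f.map (evalRingHom z)).IsRoot b ∧ (g.map (evalRingHom z)).IsRoot b := by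
      by_contra! hcon
      refine hz.2 ((isCoprime_iff_aeval_ne_zero_of_isAlgClosed ℂ ℂ _ _).mpr fun b ↦ ?_)
      rw [coe_aeval_eq_eval]
      exact or_iff_not_imp_left.mpr fun h ↦ hcon b (not_not.mp h)
    refine hline z b ?_ ?_
    · rw [← map_evalRingHom_eval]; exact hb.1
    · rw [← map_evalRingHom_eval]; exact hb.2
  -- If `r` were zero, every point of the plane would lie on the line, but `β + α i` does not.
  have hr0 : r ≠ 0 := by
    intro h0
    obtain ⟨t, ht⟩ := hroots (β + α * Complex.I) (by rw [h0, IsRoot.def, eval_zero])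
    have := congrArg Complex.im (mul_left_cancel₀ hα (add_left_cancel ht))
    simp at this
  have hCH : aeval N (f * g) = 0 := by rw [hfg]; exact Matrix.aeval_self_charpoly N
  -- From `f p + g q = r` and `(f g)(L) = 0` follows `S² = r S`: `S / r` is the projector onto the
  -- kernel of `f(L)` over `ℂ(λ)`.
  set S := aeval N (g * q) with hS
  have hSS : ∀ z, (S.map (evalRingHom z)) * S.map (evalRingHom z) = r.eval z • S.map (evalRingHom z) := by
    intro z
    have h1 : S * S = r • S := by
      have h2 : g * q * (g * q) = C r * (g * q) - f * g * (p * q) := by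
        rw [← hpq]; ring
      rw [hS, ← map_mul, h2, map_sub, map_mul _ (f * g), hCH, zero_mul, sub_zero, map_mul, aeval_C,
        Algebra.smul_def]
    have := congrArg (fun M : Matrix (Fin n) (Fin n) ℂ[X] ↦ M.map (evalRingHom z)) h1
    rw [Matrix.map_mul] at this
    rw [this]
    ext i j
    simp
  have hbound : ∀ (i j) (t : ℝ), ‖(S i j).eval (β + α * t)‖ ≤ ‖r.eval (β + α * t)‖ := by
    intro i j t
    refine norm_apply_le_of_normal (S := S.map (evalRingHom (β + α * t))) ?_ (hSS _) i j
    rw [hS, map_eval_aeval]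
    exact commute_aeval_conjTranspose (hnormal t) _
  choose E hE using fun i j ↦ exists_eq_C_mul_of_norm_le_on_line hα hr0 hroots (hbound i j)
  have hSE : S = r • (Matrix.of E).map C := by
    ext1 i j
    rw [hE]
    simp [mul_comm]
  have hcancel : ∀ M : Matrix (Fin n) (Fin n) ℂ[X], r • M = 0 → M = 0 := by
    intro M hM
    ext1 i j
    have := congrFun (congrFun hM i) j
    exact (mul_eq_zero.mp this).resolve_left hr0
  refine ⟨Matrix.of E, ?_, hcancel _ ?_, hcancel _ ?_⟩
  · rw [← sub_eq_zero]
    refine hcancel _ ?_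
    rw [smul_sub, ← smul_mul_assoc, ← mul_smul_comm, ← hSE, sub_eq_zero, hS]
    have h1 : Commute (X : ℂ[X][X]) (g * q) := Commute.all _ _
    have h2 := (h1.map (aeval N)).eq
    rw [aeval_X] at h2
    exact h2.symm
  · rw [← mul_smul_comm, ← hSE, hS, ← map_mul, ← mul_assoc, map_mul, hCH, zero_mul]
  · have h1 : r • (1 - (Matrix.of E).map C) = aeval N (f * p) := by
      have h3 : f * p = C r - g * q := by rw [← hpq]; ring
      rw [smul_sub, ← hSE, h3, map_sub, aeval_C, Algebra.algebraMap_eq_smul_one]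
    rw [← mul_smul_comm, h1, ← map_mul, show g * (f * p) = f * g * p by ring, map_mul, hCH, zero_mul]

end Projector

/-! ### Block structure in an eigenbasis of the leading coefficient. -/

section Blocks

variable {n m : ℕ}

theorem MatPoly.coeff_toPolyMatrix_last (L : MatPoly n m) (i j : Fin n) :
    (L.toPolyMatrix i j).coeff m = L.coeff (Fin.last m) i j := by
  have := L.coeff_toPolyMatrix i j (Fin.last m)
  rwa [Fin.val_last] at this

theorem MatPoly.toPolyMatrix_pow (L : MatPoly n m) (l : ℕ) (i j : Fin n) :
    ((L.toPolyMatrix ^ l) i j).natDegree ≤ m * l ∧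
      ((L.toPolyMatrix ^ l) i j).coeff (m * l) = (L.coeff (Fin.last m) ^ l) i j := by
  induction l generalizing i j with
  | zero =>
    rcases eq_or_ne i j with rfl | hij
    · simp
    · simp [hij]
  | succ l ih =>
    rw [pow_succ, pow_succ, Matrix.mul_apply, Matrix.mul_apply, Nat.mul_succ]
    constructor
    · refine natDegree_sum_le_of_forall_le _ _ fun c _ ↦ natDegree_mul_le.trans ?_
      exact add_le_add (ih i c).1 (L.natDegree_toPolyMatrix_le c j)
    · rw [finsetSum_coeff]
      refine Finset.sum_congr rfl fun c _ ↦ ?_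
      rw [coeff_mul_add_eq_of_natDegree_le (ih i c).1 (L.natDegree_toPolyMatrix_le c j), (ih i c).2,
        L.coeff_toPolyMatrix_last]

/-- In each term of `f(L)` the coefficient of `μ^l` has degree at most `m (k - l)` and `L^l` at most
`m l`, so the coefficient of `λ^(m k)` is the product of the top coefficients. -/
theorem MatPoly.coeff_aeval (L : MatPoly n m) {f : ℂ[X][X]} (hf : IsWeightedMonic m f)
    (i j : Fin n) :
    ((aeval L.toPolyMatrix f) i j).coeff (m * f.natDegree) =
      (aeval (L.coeff (Fin.last m)) (leadingForm m f)) i j := by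
  rw [aeval_eq_sum_range, aeval_eq_sum_range' (Nat.lt_succ_of_le (natDegree_leadingForm_le m f)),
    Matrix.sum_apply, Matrix.sum_apply, finsetSum_coeff]
  refine Finset.sum_congr rfl fun l hl ↦ ?_
  have hl' : l ≤ f.natDegree := Nat.lt_succ_iff.mp (Finset.mem_range.mp hl)
  rw [Matrix.smul_apply, Matrix.smul_apply, smul_eq_mul, smul_eq_mul, hf.coeff_leadingForm hl',
    ← (L.toPolyMatrix_pow l i j).2, ← coeff_mul_add_eq_of_natDegree_le (hf.natDegree_coeff_le hl')
      (L.toPolyMatrix_pow l i j).1, ← mul_add, Nat.sub_add_cancel hl']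

theorem MatPoly.aeval_mul_map_eq_zero (L : MatPoly n m) {f : ℂ[X][X]} (hf : IsWeightedMonic m f)
    {E : Matrix (Fin n) (Fin n) ℂ} (h : aeval L.toPolyMatrix f * E.map C = 0) :
    aeval (L.coeff (Fin.last m)) (leadingForm m f) * E = 0 := by
  ext i j
  have h1 := congrArg (fun p ↦ Polynomial.coeff p (m * f.natDegree)) (congrFun (congrFun h i) j)
  simp only [Matrix.mul_apply, Matrix.map_apply, finsetSum_coeff, coeff_mul_C,
    L.coeff_aeval hf, Matrix.zero_apply, coeff_zero] at h1
  rw [Matrix.mul_apply, h1, Matrix.zero_apply]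

theorem aeval_diagonal (b : Fin n → ℂ) (p : ℂ[X]) :
    aeval (Matrix.diagonal b) p = Matrix.diagonal fun i ↦ p.eval (b i) := by
  have h := aeval_algHom_apply (Matrix.diagonalAlgHom ℂ (n := Fin n) (α := ℂ)) b p
  simp only [Matrix.diagonalAlgHom_apply] at h
  rw [h]
  congr 1
  funext i
  rw [aeval_pi_apply]
  simp

theorem charpoly_diagonal_separable {b : Fin n → ℂ} (hb : Function.Injective b) :
    (Matrix.diagonal b).charpoly.Separable := by
  rw [Matrix.charpoly_diagonal]
  exact separable_prod_X_sub_C_iff.mpr hb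

/-- The matrix polynomial is block diagonal: the blocks correspond to the components of the
spectral curve. -/
theorem apply_eq_zero_of_leadingForm (L : MatPoly n m) {b : Fin n → ℂ} (hb : Function.Injective b)
    (hB : L.coeff (Fin.last m) = Matrix.diagonal b) {α β : ℂ} (hα : α ≠ 0)
    (hnormal : ∀ t : ℝ, Commute (L.eval (β + α * t)) (L.eval (β + α * t))ᴴ)
    {f g : ℂ[X][X]} (hf : f.Monic) (hg : g.Monic) (hf0 : f.natDegree ≠ 0)
    (hfg : f * g = L.toPolyMatrix.charpoly)
    (hline : ∀ z b, f.evalEval z b = 0 → g.evalEval z b = 0 → ∃ t : ℝ, z = β + α * t) :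
    (∀ i j, (leadingForm m f).eval (b i) = 0 → (leadingForm m f).eval (b j) ≠ 0 →
      L.toPolyMatrix i j = 0 ∧ L.toPolyMatrix j i = 0) ∧
    ∀ i j, (leadingForm m f).eval (b j) = 0 → aeval L.toPolyMatrix f i j = 0 := by
  obtain ⟨E, hE1, hE2, hE3⟩ := exists_projector L hα hnormal hf hg hf0 hfg hline
  obtain ⟨hwχ, hlead⟩ := isWeightedMonic_charpoly L
  rw [← hfg] at hwχ hlead
  obtain ⟨hwf, hwg⟩ := IsWeightedMonic.of_mul hf hg hwχ
  rw [leadingForm_mul, hB] at hlead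
  have hcop : IsCoprime (leadingForm m f) (leadingForm m g) :=
    (hlead ▸ charpoly_diagonal_separable hb).isCoprime
  -- The coefficient of `λ^m` in `E L = L E` says that `E` commutes with a diagonal matrix with
  -- distinct entries.
  have hdiag : ∀ i j, i ≠ j → E i j = 0 := by
    intro i j hij
    have h1 := congrArg (fun p ↦ coeff p m) (congrFun (congrFun hE1 i) j)
    simp only [Matrix.mul_apply, Matrix.map_apply, finsetSum_coeff, coeff_mul_C, coeff_C_mul,
      L.coeff_toPolyMatrix_last, hB] at h1
    rw [Finset.sum_eq_single j (by intro c _ hc; simp [hc]) (by simp),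
      Finset.sum_eq_single i (by intro c _ hc; simp [hc.symm]) (by simp)] at h1
    simp only [Matrix.diagonal_apply_eq] at h1
    have h2 : (b j - b i) * E i j = 0 := by linear_combination h1
    exact (mul_eq_zero.mp h2).resolve_left (sub_ne_zero.mpr fun h ↦ hij (hb h).symm)
  have hEd : E = Matrix.diagonal fun i ↦ E i i := by
    ext i j
    rcases eq_or_ne i j with rfl | hij
    · simp
    · simp [hij, hdiag i j hij]
  -- The top coefficients of `f(L) E = 0` and `g(L) (1 - E) = 0`; as the leading forms are coprime,
  -- `E_ii` is `1` at the roots of the form of `f` and `0` elsewhere.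
  have hF : ∀ i, (leadingForm m f).eval (b i) * E i i = 0 := by
    intro i
    have h1 := congrFun (congrFun (L.aeval_mul_map_eq_zero hwf hE2) i) i
    rwa [hB, aeval_diagonal, Matrix.diagonal_mul] at h1
  have hG : ∀ i, (leadingForm m g).eval (b i) * (1 - E i i) = 0 := by
    intro i
    have h0 : aeval L.toPolyMatrix g * (1 - E).map C = 0 := by
      rw [← hE3, Matrix.map_sub _ (map_sub _), Matrix.map_one _ (map_zero _) (map_one _)]
    have h1 := congrFun (congrFun (L.aeval_mul_map_eq_zero hwg h0) i) i
    rwa [hB, aeval_diagonal, Matrix.diagonal_mul, Matrix.sub_apply, Matrix.one_apply_eq] at h1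
  have hE1' : ∀ i, (leadingForm m f).eval (b i) = 0 → E i i = 1 := by
    intro i hi
    have hne : (leadingForm m g).eval (b i) ≠ 0 := by
      intro h0
      obtain ⟨u, w, huw⟩ := hcop
      have := congrArg (eval (b i)) huw
      rw [eval_add, eval_mul, eval_mul, hi, h0] at this
      simp at this
    have := (mul_eq_zero.mp (hG i)).resolve_left hne
    linear_combination -this
  have hE0' : ∀ i, (leadingForm m f).eval (b i) ≠ 0 → E i i = 0 := fun i hi ↦
    (mul_eq_zero.mp (hF i)).resolve_left hi
  have hEmap : E.map C = Matrix.diagonal fun i ↦ C (E i i) := by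
    conv_lhs => rw [hEd]
    rw [Matrix.diagonal_map (map_zero _)]
  refine ⟨fun i j hi hj ↦ ?_, fun i j hj ↦ ?_⟩
  · rw [hEmap] at hE1
    have h1 := congrFun (congrFun hE1 i) j
    have h2 := congrFun (congrFun hE1 j) i
    rw [Matrix.diagonal_mul, Matrix.mul_diagonal, hE1' i hi, hE0' j hj] at h1
    rw [Matrix.diagonal_mul, Matrix.mul_diagonal, hE1' i hi, hE0' j hj] at h2
    simp only [map_one, map_zero, one_mul, mul_zero, zero_mul, mul_one] at h1 h2
    exact ⟨h1, h2.symm⟩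
  · rw [hEmap] at hE2
    have h1 := congrFun (congrFun hE2 i) j
    rw [Matrix.mul_diagonal, hE1' j hj] at h1
    simpa using h1

end Blocks

/-! ### Comparison of isospectral blocks. -/

section Isospectral

open ComplexConjugate

theorem exists_irreducible_dvd_of_leadingForm (m : ℕ) (x : ℂ) (P : ℂ[X][X]) (hP : P ≠ 0)
    (h : (leadingForm m P).eval x = 0) :
    ∃ f, Irreducible f ∧ f ∣ P ∧ (leadingForm m f).eval x = 0 := by
  induction P using WfDvdMonoid.induction_on_irreducible with
  | zero => exact absurd rfl hP
  | unit u hu =>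
    exfalso
    obtain ⟨w, hw⟩ := hu.exists_right_inv
    have h1 := congrArg (fun p ↦ (leadingForm m p).eval x) hw
    simp only [leadingForm_mul, eval_mul, h, zero_mul] at h1
    simp [leadingForm] at h1
  | mul a i ha hi ih =>
    rw [leadingForm_mul, eval_mul, mul_eq_zero] at h
    rcases h with h | h
    · exact ⟨i, hi, dvd_mul_right _ _, h⟩
    · obtain ⟨f, hf, hfa, hfx⟩ := ih ha h
      exact ⟨f, hf, hfa.mul_left i, hfx⟩

/-- The leading form is multiplicative, so some component passes through the point `x` at infinity.
The leading coefficients of the two factors are inverse to each other, and exchanging them makes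
both factors monic. -/
theorem exists_monic_component (m : ℕ) {x : ℂ} {χ : ℂ[X][X]} (hχ : χ.Monic)
    (h : (leadingForm m χ).eval x = 0) :
    ∃ f g : ℂ[X][X], f.Monic ∧ g.Monic ∧ Irreducible f ∧ f * g = χ ∧
      (leadingForm m f).eval x = 0 := by
  obtain ⟨f, hf, ⟨g, rfl⟩, hfx⟩ := exists_irreducible_dvd_of_leadingForm m x χ hχ.ne_zero h
  have hlc : f.leadingCoeff * g.leadingCoeff = 1 := by
    rw [← leadingCoeff_mul]; exact hχ
  have hCC : C f.leadingCoeff * C g.leadingCoeff = (1 : ℂ[X][X]) := by rw [← C_mul, hlc, C_1]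
  have hu : IsUnit (C g.leadingCoeff : ℂ[X][X]) := IsUnit.of_mul_eq_one _ (by rw [mul_comm]; exact hCC)
  refine ⟨C g.leadingCoeff * f, C f.leadingCoeff * g, ?_, ?_, ?_, ?_, ?_⟩
  · rw [Monic, leadingCoeff_mul, leadingCoeff_C, mul_comm, hlc]
  · rw [Monic, leadingCoeff_mul, leadingCoeff_C, hlc]
  · exact (irreducible_isUnit_mul hu).mpr hf
  · linear_combination (f * g) * hCC
  · rw [leadingForm_mul, eval_mul, hfx, mul_zero]

variable {n m : ℕ}

/-- Comparison of the `i`-th rows of two isospectral matrix polynomials. -/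
theorem compare_rows {L L₀ : MatPoly n m} {b : Fin n → ℂ} (hb : Function.Injective b)
    (hB : L.coeff (Fin.last m) = Matrix.diagonal b)
    (hB₀ : L₀.coeff (Fin.last m) = Matrix.diagonal b) {α β : ℂ} (hα : α ≠ 0)
    (hL : ∀ t : ℝ, Commute (L.eval (β + α * t)) (L.eval (β + α * t))ᴴ)
    (hL₀ : ∀ t : ℝ, Commute (L₀.eval (β + α * t)) (L₀.eval (β + α * t))ᴴ)
    (hχ : L.toPolyMatrix.charpoly = L₀.toPolyMatrix.charpoly)
    {f g : ℂ[X][X]} (hf : f.Monic) (hg : g.Monic)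
    (hfg : f * g = L₀.toPolyMatrix.charpoly)
    (hdeg : f.natDegree = 1 ∨ f.natDegree = 2 ∧ m = 1)
    (hline : ∀ z b, f.evalEval z b = 0 → g.evalEval z b = 0 → ∃ t : ℝ, z = β + α * t)
    {i : Fin n} (hi : (leadingForm m f).eval (b i) = 0) :
    L.toPolyMatrix i i = L₀.toPolyMatrix i i ∧
    ∃ j, (∀ l, l ≠ i → l ≠ j → L.toPolyMatrix i l = 0 ∧ L₀.toPolyMatrix i l = 0) ∧
      (j ≠ i → m = 1 ∧ L.toPolyMatrix i j * L.toPolyMatrix j i =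
        L₀.toPolyMatrix i j * L₀.toPolyMatrix j i) := by
  have hf0 : f.natDegree ≠ 0 := by rcases hdeg with h | h <;> lia
  obtain ⟨h1, h2⟩ := apply_eq_zero_of_leadingForm L hb hB hα hL hf hg hf0 (hfg.trans hχ.symm) hline
  obtain ⟨h1₀, h2₀⟩ := apply_eq_zero_of_leadingForm L₀ hb hB₀ hα hL₀ hf hg hf0 hfg hline
  obtain ⟨hwχ, hlead⟩ := isWeightedMonic_charpoly L₀
  rw [← hfg] at hwχ hlead
  obtain ⟨hwf, hwg⟩ := IsWeightedMonic.of_mul hf hg hwχ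
  rw [leadingForm_mul, hB₀] at hlead
  have hsep : (leadingForm m f).Separable :=
    (hlead ▸ charpoly_diagonal_separable hb : (leadingForm m f * leadingForm m g).Separable).of_mul_left
  have hmon := hwf.monic_leadingForm
  have hnat := hwf.natDegree_leadingForm
  obtain ⟨h, hh⟩ := dvd_iff_isRoot.mpr hi
  have hhm : h.Monic := (monic_X_sub_C (b i)).of_mul_monic_left (hh ▸ hmon)
  have hhd : h.natDegree + 1 = f.natDegree := by
    rw [← hnat, hh, (monic_X_sub_C (b i)).natDegree_mul hhm, natDegree_X_sub_C, add_comm]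
  rcases hdeg with hdeg | ⟨hdeg, rfl⟩
  · -- a component of degree one
    have hh1 : h = 1 := hhm.natDegree_eq_zero.mp (by lia)
    rw [hh1, mul_one] at hh
    have hne : ∀ l, l ≠ i → (leadingForm m f).eval (b l) ≠ 0 := by
      intro l hl
      rw [hh, eval_sub, eval_X, eval_C, sub_ne_zero]
      exact fun e ↦ hl (hb e)
    have key : ∀ N : Matrix (Fin n) (Fin n) ℂ[X], aeval N f i i = 0 → N i i = -f.coeff 0 := by
      intro N hN
      rw [aeval_eq_sum_range, hdeg, Finset.sum_range_succ, Finset.sum_range_one,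
        show f.coeff 1 = 1 from hdeg ▸ hf.coeff_natDegree] at hN
      simp only [pow_zero, pow_one, one_smul, Matrix.add_apply, Matrix.smul_apply,
        Matrix.one_apply_eq, smul_eq_mul, mul_one] at hN
      linear_combination hN
    -- For a block of size one, `j = i` stands for the absence of a second index.
    refine ⟨(key _ (h2 i i hi)).trans (key _ (h2₀ i i hi)).symm, i, fun l hl _ ↦ ?_, fun hii ↦ absurd rfl hii⟩
    exact ⟨(h1 i l hi (hne l hl)).1, (h1₀ i l hi (hne l hl)).1⟩
  · -- a component of degree two
    obtain ⟨c, rfl⟩ : ∃ c, h = X - C c := by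
      refine ⟨-h.coeff 0, ?_⟩
      rw [C_neg, sub_neg_eq_add]
      exact hhm.eq_X_add_C (by lia)
    -- The leading form of `f` divides the characteristic polynomial of the leading term, so its
    -- second root is also an eigenvalue, distinct from `b i` by separability.
    obtain ⟨j, rfl⟩ : ∃ j, c = b j := by
      have h3 := congrArg (eval c) hlead
      rw [hh, Matrix.charpoly_diagonal, eval_prod] at h3
      simp only [eval_mul, eval_sub, eval_X, eval_C, sub_self, mul_zero, zero_mul] at h3
      obtain ⟨j, -, hj⟩ := Finset.prod_eq_zero_iff.mp h3.symm
      exact ⟨j, sub_eq_zero.mp hj⟩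
    have hij : j ≠ i := by
      rintro rfl
      have h3 : IsCoprime (X - C (b j)) (X - C (b j)) := (hh ▸ hsep).isCoprime
      rw [isCoprime_self] at h3
      exact not_isUnit_X_sub_C _ h3
    have hbij : b i - b j ≠ 0 := sub_ne_zero.mpr fun e ↦ hij (hb e).symm
    have hne : ∀ l, l ≠ i → l ≠ j → (leadingForm 1 f).eval (b l) ≠ 0 := by
      intro l hl hl'
      rw [hh, eval_mul, eval_sub, eval_sub, eval_X, eval_C, eval_C]
      exact mul_ne_zero (sub_ne_zero.mpr fun e ↦ hl (hb e)) (sub_ne_zero.mpr fun e ↦ hl' (hb e))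
    have ha1 : (f.coeff 1).coeff 1 = -(b i + b j) := by
      have h3 := hwf.coeff_leadingForm (i := 1) (by lia)
      rw [hdeg, hh] at h3
      simp only [one_mul, Nat.add_one_sub_one] at h3
      rw [← h3]
      have : ((X - C (b i)) * (X - C (b j)) : ℂ[X]) =
        C (b i * b j) + C (-(b i + b j)) * X + X ^ 2 := by
        simp only [C_mul, C_neg, C_add]; ring
      rw [this]
      simp [coeff_C]
    have key : ∀ N : Matrix (Fin n) (Fin n) ℂ[X], aeval N f i i = 0 →
        (∀ l, l ≠ i → l ≠ j → N i l = 0) →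
        f.coeff 0 + f.coeff 1 * N i i + (N i i * N i i + N i j * N j i) = 0 := by
      intro N hN hN0
      rw [aeval_eq_sum_range, hdeg, Finset.sum_range_succ, Finset.sum_range_succ,
        Finset.sum_range_one, show f.coeff 2 = 1 from hdeg ▸ hf.coeff_natDegree] at hN
      simp only [pow_zero, pow_one, one_smul, Matrix.add_apply, Matrix.smul_apply,
        Matrix.one_apply_eq, smul_eq_mul, mul_one, pow_two, Matrix.mul_apply] at hN
      rwa [Finset.sum_eq_add i j hij.symm (fun l _ hl ↦ by rw [hN0 l hl.1 hl.2, zero_mul])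
        (by simp) (by simp)] at hN
    have hz : ∀ l, l ≠ i → l ≠ j → L.toPolyMatrix i l = 0 ∧ L₀.toPolyMatrix i l = 0 :=
      fun l hl hl' ↦ ⟨(h1 i l hi (hne l hl hl')).1, (h1₀ i l hi (hne l hl hl')).1⟩
    have k1 := key _ (h2 i i hi) fun l hl hl' ↦ (hz l hl hl').1
    have k2 := key _ (h2₀ i i hi) fun l hl hl' ↦ (hz l hl hl').2
    have lin : ∀ M : MatPoly n 1, M.coeff (Fin.last 1) = Matrix.diagonal b → ∀ p q,
        M.toPolyMatrix p q = C (Matrix.diagonal b p q) * X + C ((M.toPolyMatrix p q).coeff 0) := by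
      intro M hM p q
      have h3 := eq_X_add_C_of_natDegree_le_one (M.natDegree_toPolyMatrix_le p q)
      rwa [M.coeff_toPolyMatrix_last, hM] at h3
    have e1 := lin L hB i i
    have e2 := lin L hB i j
    have e3 := lin L hB j i
    have e1₀ := lin L₀ hB₀ i i
    have e2₀ := lin L₀ hB₀ i j
    have e3₀ := lin L₀ hB₀ j i
    rw [Matrix.diagonal_apply_eq] at e1 e1₀
    rw [Matrix.diagonal_apply_ne _ hij.symm, C_0, zero_mul, zero_add] at e2 e2₀
    rw [Matrix.diagonal_apply_ne _ hij, C_0, zero_mul, zero_add] at e3 e3₀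
    set x := (L.toPolyMatrix i i).coeff 0
    set y := (L₀.toPolyMatrix i i).coeff 0
    -- Difference of the two quadratic relations. Its `λ`-coefficient is `(x - y) (2 b_i - (b_i +
    -- b_j))`, since the off-diagonal products are constant; hence `x = y`.
    have hsub : C (x - y) * (C (2 * b i) * X + C (x + y) + f.coeff 1) +
        C ((L.toPolyMatrix i j).coeff 0 * (L.toPolyMatrix j i).coeff 0 -
          (L₀.toPolyMatrix i j).coeff 0 * (L₀.toPolyMatrix j i).coeff 0) = 0 := by
      rw [e1, e2, e3] at k1
      rw [e1₀, e2₀, e3₀] at k2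
      simp only [C_sub, C_mul, C_add, C_ofNat] at k1 k2 ⊢
      linear_combination k1 - k2
    have hxy : x = y := by
      have h3 := congrArg (fun p ↦ coeff p 1) hsub
      simp only [coeff_add, coeff_C_mul, coeff_X_one, coeff_C_succ, coeff_zero, ha1, mul_one,
        add_zero] at h3
      have h4 : (x - y) * (b i - b j) = 0 := by linear_combination h3
      exact sub_eq_zero.mp ((mul_eq_zero.mp h4).resolve_right hbij)
    have hii : L.toPolyMatrix i i = L₀.toPolyMatrix i i := by rw [e1, e1₀, hxy]
    refine ⟨hii, j, hz, fun _ ↦ ⟨rfl, ?_⟩⟩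
    rw [hii] at k1
    linear_combination k1 - k2

end Isospectral

/-! ### Conjugation by diagonal unitary matrices. -/

section Phases

open ComplexConjugate

variable {n m : ℕ}

/-- Two arrays with the same moduli, `c_{ij} = σ \bar c_{ji}`, and at most one non-zero entry in each
row, are conjugate by a diagonal unitary matrix. -/
theorem exists_phases_of_norm_eq {c c₀ : Fin n → Fin n → ℂ} {σ : ℂ}
    (hc : ∀ i j, c i j = σ * conj (c j i)) (hc₀ : ∀ i j, c₀ i j = σ * conj (c₀ j i))
    (hnorm : ∀ i j, i ≠ j → ‖c i j‖ = ‖c₀ i j‖)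
    (huniq : ∀ i j l, i ≠ j → i ≠ l → c₀ i j ≠ 0 → c₀ i l ≠ 0 → j = l) :
    ∃ q : Fin n → ℂ, (∀ i, ‖q i‖ = 1) ∧ ∀ i j, i ≠ j → c i j = conj (q i) * c₀ i j * q j := by
  classical
  have hsymm : ∀ i j, c₀ i j ≠ 0 → c₀ j i ≠ 0 := fun i j h h' ↦ h (by rw [hc₀, h', map_zero, mul_zero])
  -- The non-zero off-diagonal entries of `c₀` match indices in disjoint pairs. The larger index of
  -- a pair carries the whole phase; all other indices get `1`.
  let q : Fin n → ℂ := fun j ↦ if h : ∃ i, i < j ∧ c₀ i j ≠ 0 then c h.choose j / c₀ h.choose j else 1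
  have hq1 : ∀ i, ‖q i‖ = 1 := by
    intro j
    by_cases h : ∃ i, i < j ∧ c₀ i j ≠ 0
    · simp only [q, dif_pos h, norm_div]
      rw [hnorm _ _ h.choose_spec.1.ne, div_self (norm_ne_zero_iff.mpr h.choose_spec.2)]
    · simp only [q, dif_neg h, norm_one]
  have hlt : ∀ i j, i < j → c i j = conj (q i) * c₀ i j * q j := by
    intro i j hij
    by_cases h0 : c₀ i j = 0
    · have := hnorm i j hij.ne
      rw [h0, norm_zero, norm_eq_zero] at this
      rw [this, h0]; ring
    · have hj : ∃ i, i < j ∧ c₀ i j ≠ 0 := ⟨i, hij, h0⟩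
      have hch : hj.choose = i := huniq j _ _ hj.choose_spec.1.ne' hij.ne'
        (hsymm _ _ hj.choose_spec.2) (hsymm _ _ h0)
      have hqj : q j = c i j / c₀ i j := by
        simp only [q, dif_pos hj, hch]
      have hqi : q i = 1 := by
        refine dif_neg ?_
        rintro ⟨l, hl, hl0⟩
        have := huniq i l j hl.ne' hij.ne (hsymm _ _ hl0) h0
        exact absurd (this ▸ hl) hij.not_gt
      rw [hqi, hqj, map_one, one_mul, mul_div_cancel₀ _ h0]
  refine ⟨q, hq1, fun i j hij ↦ ?_⟩
  rcases lt_or_gt_of_ne hij with h | h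
  · exact hlt i j h
  · rw [hc i j, hlt j i h, hc₀ i j]
    simp only [map_mul, Complex.conj_conj]
    ring

/-- Isospectral matrix polynomials with the same diagonal leading term are conjugate by a diagonal
unitary matrix, if the components of the spectral curve are lines and conics. -/
theorem exists_phases {L L₀ : MatPoly n m} {b : Fin n → ℂ} (hb : Function.Injective b)
    (hB : L.coeff (Fin.last m) = Matrix.diagonal b)
    (hB₀ : L₀.coeff (Fin.last m) = Matrix.diagonal b) {α β σ : ℂ} (hα : α ≠ 0) (hσ : ‖σ‖ = 1)
    (hL : ∀ t : ℝ, L.eval (β + α * t) = σ • (L.eval (β + α * t))ᴴ)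
    (hL₀ : ∀ t : ℝ, L₀.eval (β + α * t) = σ • (L₀.eval (β + α * t))ᴴ)
    (hχ : L.toPolyMatrix.charpoly = L₀.toPolyMatrix.charpoly)
    (hdeg : ∀ f : ℂ[X][X], f.Monic → Irreducible f → f ∣ L₀.toPolyMatrix.charpoly →
      f.natDegree = 1 ∨ f.natDegree = 2 ∧ m = 1)
    (hline : ∀ f g : ℂ[X][X], f * g = L₀.toPolyMatrix.charpoly →
      ∀ z b, f.evalEval z b = 0 → g.evalEval z b = 0 → ∃ t : ℝ, z = β + α * t) :
    ∃ q : Fin n → ℂ, (∀ i, ‖q i‖ = 1) ∧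
      ∀ k i j, L k i j = conj (q i) * L₀ k i j * q j := by
  have hcomm : ∀ M : Matrix (Fin n) (Fin n) ℂ, M = σ • Mᴴ → Commute M Mᴴ := by
    intro M hM
    have : Commute (σ • Mᴴ) Mᴴ := (Commute.refl Mᴴ).smul_left σ
    rwa [← hM] at this
  have hrow : ∀ i, L.toPolyMatrix i i = L₀.toPolyMatrix i i ∧
      ∃ j, (∀ l, l ≠ i → l ≠ j → L.toPolyMatrix i l = 0 ∧ L₀.toPolyMatrix i l = 0) ∧
        (j ≠ i → m = 1 ∧ L.toPolyMatrix i j * L.toPolyMatrix j i =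
          L₀.toPolyMatrix i j * L₀.toPolyMatrix j i) := by
    intro i
    obtain ⟨f, g, hf, hg, hfi, hfg, hfx⟩ := exists_monic_component m (x := b i)
      L₀.toPolyMatrix.charpoly_monic (by
        rw [(isWeightedMonic_charpoly L₀).2, hB₀, Matrix.charpoly_diagonal, eval_prod]
        exact Finset.prod_eq_zero (Finset.mem_univ i) (by simp))
    exact compare_rows hb hB hB₀ hα (fun t ↦ hcomm _ (hL t)) (fun t ↦ hcomm _ (hL₀ t)) hχ hf hg hfg
      (hdeg f hf hfi ⟨g, hfg.symm⟩) (hline f g hfg) hfx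
  have hconst : ∀ i j, i ≠ j → L.toPolyMatrix i j = C ((L.toPolyMatrix i j).coeff 0) ∧
      L₀.toPolyMatrix i j = C ((L₀.toPolyMatrix i j).coeff 0) := by
    intro i j hij
    obtain ⟨-, l, hl, hl'⟩ := hrow i
    rcases eq_or_ne j l with rfl | hjl
    · obtain ⟨rfl, -⟩ := hl' hij.symm
      have lin : ∀ M : MatPoly n 1, M.coeff (Fin.last 1) = Matrix.diagonal b →
          M.toPolyMatrix i j = C ((M.toPolyMatrix i j).coeff 0) := by
        intro M hM
        have h3 := eq_X_add_C_of_natDegree_le_one (M.natDegree_toPolyMatrix_le i j)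
        rwa [M.coeff_toPolyMatrix_last, hM, Matrix.diagonal_apply_ne _ hij, C_0, zero_mul,
          zero_add] at h3
      exact ⟨lin L hB, lin L₀ hB₀⟩
    · obtain ⟨h1, h2⟩ := hl j hij.symm hjl
      rw [h1, h2]
      simp
  have hval : ∀ M : MatPoly n m, ∀ z i j, M.eval z i j = (M.toPolyMatrix i j).eval z := by
    intro M z i j
    rw [← M.map_eval_toPolyMatrix]
    rfl
  -- The off-diagonal entries are constant, so they can be read at the point `β` of the line, where
  -- the symmetry applies.
  let c : Fin n → Fin n → ℂ := fun i j ↦ (L.eval β) i j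
  let c₀ : Fin n → Fin n → ℂ := fun i j ↦ (L₀.eval β) i j
  have hc' : ∀ i j, i ≠ j → L.toPolyMatrix i j = C (c i j) := by
    intro i j hij
    have h1 := (hconst i j hij).1
    have h2 : c i j = (L.toPolyMatrix i j).coeff 0 := by
      change L.eval β i j = _
      rw [hval, h1, eval_C, coeff_C_zero]
    rwa [h2]
  have hc₀' : ∀ i j, i ≠ j → L₀.toPolyMatrix i j = C (c₀ i j) := by
    intro i j hij
    have h1 := (hconst i j hij).2
    have h2 : c₀ i j = (L₀.toPolyMatrix i j).coeff 0 := by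
      change L₀.eval β i j = _
      rw [hval, h1, eval_C, coeff_C_zero]
    rwa [h2]
  have hherm : ∀ i j, c i j = σ * conj (c j i) := by
    intro i j
    have := congrFun (congrFun (hL 0) i) j
    simpa using this
  have hherm₀ : ∀ i j, c₀ i j = σ * conj (c₀ j i) := by
    intro i j
    have := congrFun (congrFun (hL₀ 0) i) j
    simpa using this
  have hns : ∀ i j, ‖c j i‖ = ‖c i j‖ := fun i j ↦ by
    rw [hherm i j, norm_mul, hσ, one_mul, RCLike.norm_conj]
  have hns₀ : ∀ i j, ‖c₀ j i‖ = ‖c₀ i j‖ := fun i j ↦ by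
    rw [hherm₀ i j, norm_mul, hσ, one_mul, RCLike.norm_conj]
  -- Opposite entries have equal moduli, so equal products `c_ij c_ji` give equal `|c_ij|²`.
  have hnorm : ∀ i j, i ≠ j → ‖c i j‖ = ‖c₀ i j‖ := by
    intro i j hij
    obtain ⟨-, l, hl, hl'⟩ := hrow i
    rcases eq_or_ne j l with rfl | hjl
    · have h1 := (hl' hij.symm).2
      rw [hc' i j hij, hc' j i hij.symm, hc₀' i j hij, hc₀' j i hij.symm, ← C_mul, ← C_mul] at h1
      have h2 := congrArg norm (C_injective h1)
      rw [norm_mul, norm_mul, hns i j, hns₀ i j] at h2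
      exact (mul_self_inj (norm_nonneg _) (norm_nonneg _)).mp h2
    · obtain ⟨h1, h2⟩ := hl j hij.symm hjl
      rw [hc' i j hij, C_eq_zero] at h1
      rw [hc₀' i j hij, C_eq_zero] at h2
      rw [h1, h2]
  have huniq : ∀ i j l, i ≠ j → i ≠ l → c₀ i j ≠ 0 → c₀ i l ≠ 0 → j = l := by
    intro i j l hij hil hj0 hl0
    obtain ⟨-, k, hk, -⟩ := hrow i
    have hpart : ∀ j, i ≠ j → c₀ i j ≠ 0 → j = k := by
      intro j hij hj0
      by_contra hjk
      have := (hk j hij.symm hjk).2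
      rw [hc₀' i j hij, C_eq_zero] at this
      exact hj0 this
    rw [hpart j hij hj0, hpart l hil hl0]
  obtain ⟨q, hq1, hq⟩ := exists_phases_of_norm_eq hherm hherm₀ hnorm huniq
  refine ⟨q, hq1, fun k i j ↦ ?_⟩
  rw [← L.coeff_toPolyMatrix i j k, ← L₀.coeff_toPolyMatrix i j k]
  rcases eq_or_ne i j with rfl | hij
  · rw [(hrow i).1]
    have h1 : conj (q i) * q i = 1 := by
      rw [mul_comm, Complex.mul_conj, Complex.normSq_eq_norm_sq, hq1]; simp
    linear_combination -(L₀.toPolyMatrix i i).coeff k * h1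
  · rw [hc' i j hij, hc₀' i j hij, hq i j hij, coeff_C, coeff_C]
    split_ifs <;> simp

end Phases

/-! ### Isospectral sets and gauge orbits. -/

section Gauge

open scoped ComplexConjugate

variable {n m : ℕ}

theorem coeff_comp_linear {p : ℂ[X]} (hp : p.natDegree ≤ m) {α : ℂ} (hα : α ≠ 0) (β : ℂ) :
    (p.comp (C α * X + C β)).coeff m = p.coeff m * α ^ m := by
  have hq : (C α * X + C β).natDegree = 1 := natDegree_linear hα
  rcases hp.lt_or_eq with h | rfl
  · rw [coeff_eq_zero_of_natDegree_lt h, zero_mul, coeff_eq_zero_of_natDegree_lt]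
    rwa [natDegree_comp, hq, mul_one]
  · have h := coeff_comp_degree_mul_degree (p := p) (q := C α * X + C β) (by simp [hq])
    rwa [hq, mul_one, leadingCoeff_linear hα] at h

/-- The leading coefficient is self-adjoint up to a scalar factor. -/
theorem leading_coeff_eq_of_line {L : MatPoly n m} {α β σ : ℂ} (hα : α ≠ 0)
    (hL : ∀ t : ℝ, L.eval (β + α * t) = σ • (L.eval (β + α * t))ᴴ) :
    α ^ m • L.coeff (Fin.last m) = σ • (α ^ m • L.coeff (Fin.last m))ᴴ := by
  ext i j
  set q : ℂ[X] := C α * X + C β with hq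
  -- In the real parameter `t` of the line the symmetry is an identity of polynomials, whose
  -- coefficients of `t^m` can be compared.
  have hpoly : (L.toPolyMatrix i j).comp q =
      C σ * ((L.toPolyMatrix j i).comp q).map (starRingEnd ℂ) := by
    refine eq_of_infinite_eval_eq _ _ (Set.Infinite.mono ?_
      (Set.infinite_range_of_injective Complex.ofReal_injective))
    rintro _ ⟨t, rfl⟩
    have hval : ∀ i j, ((L.toPolyMatrix i j).comp q).eval (t : ℂ) = L.eval (β + α * t) i j := by
      intro i j
      rw [eval_comp, ← MatPoly.map_eval_toPolyMatrix]
      simp [hq, add_comm]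
    have hconj : (((L.toPolyMatrix j i).comp q).map (starRingEnd ℂ)).eval (t : ℂ) =
        conj (((L.toPolyMatrix j i).comp q).eval (t : ℂ)) := by
      rw [eval_map]
      conv_lhs => rw [← Complex.conj_ofReal t]
      rw [eval₂_at_apply]
    rw [Set.mem_ofPred_eq, eval_mul, eval_C, hconj, hval, hval]
    simpa using congrFun (congrFun (hL t) i) j
  have h := congrArg (fun p ↦ Polynomial.coeff p m) hpoly
  simp only [coeff_C_mul, coeff_map] at h
  rw [coeff_comp_linear (L.natDegree_toPolyMatrix_le i j) hα,
    coeff_comp_linear (L.natDegree_toPolyMatrix_le j i) hα, L.coeff_toPolyMatrix_last,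
    L.coeff_toPolyMatrix_last] at h
  simp only [Matrix.smul_apply, Matrix.conjTranspose_apply, smul_eq_mul]
  rw [mul_comm, h, mul_comm (α ^ m)]
  rfl

/-- For `c² = σ⁻¹` one has `c σ = conj c`, so `c a B` is Hermitian and the spectral theorem applies.
-/
theorem exists_unitary_diagonal {B : Matrix (Fin n) (Fin n) ℂ} {a σ : ℂ} (ha : a ≠ 0)
    (hσ : ‖σ‖ = 1) (h : a • B = σ • (a • B)ᴴ) :
    ∃ (U : Matrix.unitaryGroup (Fin n) ℂ) (b : Fin n → ℂ),
      B = (U : Matrix (Fin n) (Fin n) ℂ) * Matrix.diagonal b * (U : Matrix (Fin n) (Fin n) ℂ)ᴴ := by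
  obtain ⟨c, hc⟩ := IsAlgClosed.exists_pow_nat_eq (σ⁻¹) (n := 2) two_pos
  have hc1 : ‖c‖ = 1 := by
    have := congrArg norm hc
    rw [norm_pow, norm_inv, hσ, inv_one] at this
    exact (pow_eq_one_iff_of_nonneg (norm_nonneg _) two_ne_zero).mp this
  have hc0 : c ≠ 0 := norm_ne_zero_iff.mp (by rw [hc1]; exact one_ne_zero)
  have hσ0 : σ ≠ 0 := norm_ne_zero_iff.mp (by rw [hσ]; exact one_ne_zero)
  have hcc : conj c * c = 1 := by
    rw [mul_comm, Complex.mul_conj, Complex.normSq_eq_norm_sq, hc1]; simp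
  have hcσ : c * σ = conj c := by
    apply mul_right_cancel₀ hc0
    rw [hcc]
    have : c ^ 2 * σ = 1 := by rw [hc, inv_mul_cancel₀ hσ0]
    linear_combination this
  have hH : (c • (a • B)).IsHermitian := by
    rw [Matrix.IsHermitian, Matrix.conjTranspose_smul]
    conv_rhs => rw [h, smul_smul, hcσ]
    rfl
  have hspec := hH.spectral_theorem
  rw [Unitary.conjStarAlgAut_apply] at hspec
  refine ⟨hH.eigenvectorUnitary, fun i ↦ (c * a)⁻¹ * (hH.eigenvalues i : ℂ), ?_⟩
  have h1 : Matrix.diagonal (fun i ↦ (c * a)⁻¹ * (hH.eigenvalues i : ℂ)) =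
      (c * a)⁻¹ • Matrix.diagonal (fun i ↦ (hH.eigenvalues i : ℂ)) := by
    rw [← Matrix.diagonal_smul]; rfl
  have h2 : B = (c * a)⁻¹ • (c • (a • B)) := by
    rw [smul_smul, smul_smul, mul_assoc, inv_mul_cancel₀ (mul_ne_zero hc0 ha), one_smul]
  rw [h1, Matrix.mul_smul, Matrix.smul_mul]
  conv_lhs => rw [h2, hspec]
  rfl

/-- The matrix polynomial `V L_λ U`. -/
def MatPoly.mulBoth (V : Matrix (Fin n) (Fin n) ℂ) (L : MatPoly n m)
    (U : Matrix (Fin n) (Fin n) ℂ) : MatPoly n m :=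
  fun k ↦ V * L.coeff k * U

theorem MatPoly.coeff_mulBoth (V : Matrix (Fin n) (Fin n) ℂ) (L : MatPoly n m)
    (U : Matrix (Fin n) (Fin n) ℂ) (k : Fin (m + 1)) :
    (L.mulBoth V U).coeff k = V * L.coeff k * U := rfl

theorem MatPoly.eval_mulBoth (V : Matrix (Fin n) (Fin n) ℂ) (L : MatPoly n m)
    (U : Matrix (Fin n) (Fin n) ℂ) (z : ℂ) : (L.mulBoth V U).eval z = V * L.eval z * U := by
  simp only [MatPoly.eval, coeff_mulBoth, Finset.mul_sum, Finset.sum_mul, Matrix.mul_smul,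
    Matrix.smul_mul]

theorem MatPoly.toPolyMatrix_mulBoth (V : Matrix (Fin n) (Fin n) ℂ) (L : MatPoly n m)
    (U : Matrix (Fin n) (Fin n) ℂ) :
    (L.mulBoth V U).toPolyMatrix = V.map C * L.toPolyMatrix * U.map C := by
  simp only [MatPoly.toPolyMatrix, coeff_mulBoth, Finset.mul_sum, Finset.sum_mul, Matrix.mul_smul,
    Matrix.smul_mul, Matrix.map_mul]

theorem charpoly_conj {R : Type*} [CommRing R] {U V : Matrix (Fin n) (Fin n) R} (h : U * V = 1)
    (A : Matrix (Fin n) (Fin n) R) : (V * A * U).charpoly = A.charpoly := by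
  rw [Matrix.charpoly_mul_comm, ← mul_assoc, h, one_mul]

theorem MatPoly.charpoly_mulBoth {U V : Matrix (Fin n) (Fin n) ℂ} (h : U * V = 1)
    (L : MatPoly n m) : (L.mulBoth V U).toPolyMatrix.charpoly = L.toPolyMatrix.charpoly := by
  rw [toPolyMatrix_mulBoth, charpoly_conj]
  rw [← Matrix.map_mul, h, Matrix.map_one _ C_0 C_1]

theorem charpoly_eq_of_spectralPoly_eq {L L₀ : MatPoly n m} (h : spectralPoly L = spectralPoly L₀) :
    L.toPolyMatrix.charpoly = L₀.toPolyMatrix.charpoly := by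
  rw [spectralPoly_eq, spectralPoly_eq] at h
  exact mul_left_cancel₀ (pow_ne_zero _ (neg_ne_zero.mpr one_ne_zero)) h

theorem dvd_spectralPoly_iff {L : MatPoly n m} {f : ℂ[X][X]} :
    f ∣ spectralPoly L ↔ f ∣ L.toPolyMatrix.charpoly := by
  have hu : IsUnit ((-1 : ℂ[X][X]) ^ n) :=
    (isUnit_one (M := ℂ[X][X])).neg.pow n
  rw [spectralPoly_eq, hu.dvd_mul_left]

/-- Two factors of the equation of a curve can only vanish simultaneously at a singular point. -/
theorem isSingularPoint_mul {f g : ℂ[X][X]} {a b : ℂ} (hf : f.evalEval a b = 0)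
    (hg : g.evalEval a b = 0) : IsSingularPoint (f * g) a b := by
  refine ⟨by rw [evalEval_mul, hf, zero_mul], ?_, ?_⟩
  · rw [eval_mul, derivative_mul, eval_add, eval_mul, eval_mul]
    simp only [evalEval] at hf hg
    rw [hf, hg, mul_zero, zero_mul, add_zero]
  · have hf' : (f.map (evalRingHom a)).eval b = 0 := by rwa [map_evalRingHom_eval]
    have hg' : (g.map (evalRingHom a)).eval b = 0 := by rwa [map_evalRingHom_eval]
    rw [Polynomial.map_mul, derivative_mul, eval_add, eval_mul, eval_mul, hf', hg', mul_zero,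
      zero_mul, add_zero]

theorem isSingularPoint_spectralPoly {L : MatPoly n m} {f g : ℂ[X][X]}
    (hfg : f * g = L.toPolyMatrix.charpoly) {a b : ℂ} (hf : f.evalEval a b = 0)
    (hg : g.evalEval a b = 0) : IsSingularPoint (spectralPoly L) a b := by
  rw [spectralPoly_eq, ← hfg, ← mul_assoc]
  exact isSingularPoint_mul (by rw [evalEval_mul, hf, mul_zero]) hg

/-- A smooth component of genus zero is rational over the `λ`-line, or a conic. -/
theorem natDegree_component {L : MatPoly n m} {τ : ℂ → ℂ} {σ : ℂ}
    (hcurve : SpectralCurveConditions τ σ L) (hm : m ≠ 0)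
    (hsep : (L.coeff (Fin.last m)).charpoly.Separable) {f : ℂ[X][X]} (hf : f.Monic)
    (hirr : Irreducible f) (hdvd : f ∣ L.toPolyMatrix.charpoly) :
    f.natDegree = 1 ∨ f.natDegree = 2 ∧ m = 1 := by
  have hcomp : IsComponent (spectralPoly L) f := ⟨hirr, dvd_spectralPoly_iff.mpr hdvd⟩
  obtain ⟨g, hg⟩ := hdvd
  obtain ⟨hχ, hlead⟩ := isWeightedMonic_charpoly L
  have hgm : g.Monic := hf.of_mul_monic_left (hg ▸ hχ.monic)
  rw [hg] at hχ hlead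
  obtain ⟨hfw, hgw⟩ := IsWeightedMonic.of_mul hf hgm hχ
  have hfsep : (leadingForm m f).Separable := by
    rw [← hlead, leadingForm_mul] at hsep
    exact hsep.of_mul_left
  have hlt : ¬ 2 ≤ m * (f.natDegree - 1) := fun h ↦
    curveGenus_ne_zero hirr hfw hfsep (hcurve.smooth f hcomp) h (hcurve.genus_zero f hcomp)
  have hpos : f.natDegree ≠ 0 := fun h ↦ hirr.not_isUnit (by
    rw [hf.natDegree_eq_zero.mp h]; exact isUnit_one)
  obtain ⟨k, hk⟩ := Nat.exists_eq_succ_of_ne_zero hpos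
  rw [hk] at hlt ⊢
  rcases k with _ | _ | k
  · exact Or.inl rfl
  · refine Or.inr ⟨rfl, ?_⟩
    simp at hlt
    omega
  · exfalso
    apply hlt
    have : 1 * 2 ≤ m * (k + 1 + 1) := Nat.mul_le_mul (Nat.one_le_iff_ne_zero.mpr hm) (by omega)
    simpa using this

theorem self_mem_gaugeOrbit (B : Matrix (Fin n) (Fin n) ℂ) (L : MatPoly n m) :
    L ∈ gaugeOrbit B L := ⟨1, by simp, fun k ↦ by simp⟩

/-- The common level sets of the coefficients of the spectral polynomial through a matrix polynomial
with a nodal rational spectral curve are contained in its gauge orbit. -/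
theorem mem_gaugeOrbit_of_spectralValues_eq {B : Matrix (Fin n) (Fin n) ℂ}
    (hB : HasSimpleSpectrum B) {τ : ℂ → ℂ} (hτ : IsAntiholomorphicInvolution τ) {σ : ℂ}
    (hσ : ‖σ‖ = 1) {L L₀ : MatPoly n m} (hL : L ∈ realMatPoly n m B τ σ)
    (hL₀ : L₀ ∈ realMatPoly n m B τ σ) (hcurve : SpectralCurveConditions τ σ L₀)
    (h : spectralValues L = spectralValues L₀) : L ∈ gaugeOrbit B L₀ := by
  -- For `m = 0` the only coefficient is `B`; the degree bound from the genus requires `m > 0`.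
  rcases Nat.eq_zero_or_pos m with rfl | hm
  · have hLL₀ : L = L₀ := by
      funext k
      have hk : k = Fin.last 0 := Fin.ext (by omega)
      rw [hk]
      exact hL.1.trans hL₀.1.symm
    exact hLL₀ ▸ self_mem_gaugeOrbit B L
  obtain ⟨α, β, hα, hline⟩ := hτ.exists_line
  have hreal : ∀ K ∈ realMatPoly n m B τ σ, ∀ t : ℝ,
      K.eval (β + α * t) = σ • (K.eval (β + α * t))ᴴ := by
    intro K hK t
    have := hK.2 (β + α * t)
    rwa [hline, Complex.conj_ofReal] at this
  obtain ⟨U, b, hU⟩ := exists_unitary_diagonal (pow_ne_zero m hα) hσ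
    (hL.1 ▸ leading_coeff_eq_of_line hα (hreal L hL))
  set V : Matrix (Fin n) (Fin n) ℂ := (U : Matrix (Fin n) (Fin n) ℂ) with hV
  have hVV : V * Vᴴ = 1 := Matrix.mem_unitaryGroup_iff.mp U.2
  have hVV' : Vᴴ * V = 1 := Matrix.mem_unitaryGroup_iff'.mp U.2
  have hBsep : B.charpoly.Separable :=
    (nodup_roots_iff_of_splits B.charpoly_monic.ne_zero (IsAlgClosed.splits _)).mp hB
  have hb : Function.Injective b := by
    have : B.charpoly = (Matrix.diagonal b).charpoly := by
      rw [hU]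
      exact charpoly_conj hVV' _
    rw [this, Matrix.charpoly_diagonal] at hBsep
    exact separable_prod_X_sub_C_iff.mp hBsep
  have hdiag : Vᴴ * B * V = Matrix.diagonal b := by
    rw [hU, mul_assoc, mul_assoc, mul_assoc, hVV', mul_one, ← mul_assoc, hVV', one_mul]
  have hreal' : ∀ K ∈ realMatPoly n m B τ σ, ∀ t : ℝ, (K.mulBoth Vᴴ V).eval (β + α * t) =
      σ • ((K.mulBoth Vᴴ V).eval (β + α * t))ᴴ := by
    intro K hK t
    rw [MatPoly.eval_mulBoth, Matrix.conjTranspose_mul, Matrix.conjTranspose_mul,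
      Matrix.conjTranspose_conjTranspose, ← mul_assoc, ← Matrix.smul_mul, ← Matrix.mul_smul,
      ← hreal K hK t]
  have hχ := charpoly_eq_of_spectralPoly_eq (spectralPoly_eq_of_spectralValues_eq h)
  obtain ⟨q, hq, hLq⟩ := exists_phases (L := L.mulBoth Vᴴ V) (L₀ := L₀.mulBoth Vᴴ V) hb
    (by rw [MatPoly.coeff_mulBoth, hL.1, hdiag]) (by rw [MatPoly.coeff_mulBoth, hL₀.1, hdiag]) hα hσ
    (hreal' L hL) (hreal' L₀ hL₀)
    (by rw [MatPoly.charpoly_mulBoth hVV, MatPoly.charpoly_mulBoth hVV, hχ])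
    (fun f hf hirr hdvd ↦ by
      rw [MatPoly.charpoly_mulBoth hVV] at hdvd
      exact natDegree_component hcurve hm.ne' (hL₀.1 ▸ hBsep) hf hirr hdvd)
    -- Common zeros of complementary factors are singular points, so `τ` fixes their `λ`-coordinate,
    -- which places it on the line.
    (fun f g hfg z b hf hg ↦ by
      rw [MatPoly.charpoly_mulBoth hVV] at hfg
      exact (fixed_iff_of_line hα hline z).mp
        (hcurve.singular_fixed z b (isSingularPoint_spectralPoly hfg hf hg)).1)
  set D : Matrix (Fin n) (Fin n) ℂ := Matrix.diagonal q with hD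
  have hDD : D * Dᴴ = 1 := by
    rw [hD, Matrix.diagonal_conjTranspose, Matrix.diagonal_mul_diagonal, ← Matrix.diagonal_one]
    congr 1
    funext i
    rw [Pi.star_apply, RCLike.star_def, Complex.mul_conj, Complex.normSq_eq_norm_sq, hq]
    simp
  have hDL : ∀ k, Vᴴ * L.coeff k * V = Dᴴ * (Vᴴ * L₀.coeff k * V) * D := by
    intro k
    ext i j
    rw [hD, Matrix.diagonal_conjTranspose, Matrix.mul_diagonal, Matrix.diagonal_mul]
    exact hLq k i j
  -- Back in the original basis the gauge transformation is `V D V*`; it commutes with `B` because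
  -- `D` and `diagonal b` commute.
  have hQ : V * D * Vᴴ ∈ Matrix.unitaryGroup (Fin n) ℂ := by
    rw [Matrix.mem_unitaryGroup_iff, Matrix.star_eq_conjTranspose, Matrix.conjTranspose_mul,
      Matrix.conjTranspose_mul, Matrix.conjTranspose_conjTranspose]
    calc V * D * Vᴴ * (V * (Dᴴ * Vᴴ)) = V * D * (Vᴴ * V) * Dᴴ * Vᴴ := by noncomm_ring
      _ = V * (D * Dᴴ) * Vᴴ := by rw [hVV', mul_one, mul_assoc V D]
      _ = 1 := by rw [hDD, mul_one, hVV]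
  refine ⟨⟨V * D * Vᴴ, hQ⟩, ?_, fun k ↦ ?_⟩
  · change V * D * Vᴴ * B = B * (V * D * Vᴴ)
    have hcomm : D * Matrix.diagonal b = Matrix.diagonal b * D := by
      rw [hD, Matrix.diagonal_mul_diagonal, Matrix.diagonal_mul_diagonal]
      simp only [mul_comm]
    rw [hU]
    calc V * D * Vᴴ * (V * Matrix.diagonal b * Vᴴ)
        = V * D * (Vᴴ * V) * Matrix.diagonal b * Vᴴ := by noncomm_ring
      _ = V * (D * Matrix.diagonal b) * Vᴴ := by rw [hVV', mul_one, mul_assoc V D]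
      _ = V * Matrix.diagonal b * (Vᴴ * V) * D * Vᴴ := by
        rw [hcomm, hVV', mul_one, mul_assoc V (Matrix.diagonal b)]
      _ = V * Matrix.diagonal b * Vᴴ * (V * D * Vᴴ) := by noncomm_ring
  · change L.coeff k = (V * D * Vᴴ)ᴴ * L₀.coeff k * (V * D * Vᴴ)
    rw [Matrix.conjTranspose_mul, Matrix.conjTranspose_mul, Matrix.conjTranspose_conjTranspose]
    calc L.coeff k = V * Vᴴ * L.coeff k * (V * Vᴴ) := by rw [hVV, one_mul, mul_one]
      _ = V * (Vᴴ * L.coeff k * V) * Vᴴ := by noncomm_ring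
      _ = V * (Dᴴ * (Vᴴ * L₀.coeff k * V) * D) * Vᴴ := by rw [hDL]
      _ = V * (Dᴴ * Vᴴ) * L₀.coeff k * (V * D * Vᴴ) := by noncomm_ring

end Gauge

end LaxStability

end

/-! ### The stability theorem. -/

theorem theorem1 {n m d : ℕ}
    (B : Matrix (Fin n) (Fin n) ℂ) (hB : LaxStability.HasSimpleSpectrum B)
    (τ : ℂ → ℂ) (hτ : LaxStability.IsAntiholomorphicInvolution τ)
    (σ : ℂ) (hσ : ‖σ‖ = 1)
    {M : Type*} [TopologicalSpace M] [ChartedSpace (EuclideanSpace ℝ (Fin d)) M]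
    [IsManifold (𝓡 d) ∞ M]
    (ι : M → LaxStability.MatPoly n m)
    (hι : Manifold.IsSmoothEmbedding (𝓡 d) 𝓘(ℝ, LaxStability.MatPoly n m) ∞ ι)
    (hιB : ∀ x, ι x ∈ LaxStability.realMatPoly n m B τ σ)
    (v : ∀ x : M, TangentSpace (𝓡 d) x)
    (hv : ContMDiff (𝓡 d) (𝓡 d).tangent 1 (fun x => (⟨x, v x⟩ : TangentBundle (𝓡 d) M)))
    (A : M → Matrix (Fin n) (Fin n) (RatFunc ℂ))
    (hLax : LaxStability.IsLaxRepresentation v ι A)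
    (x₀ : M)
    (hcurve : LaxStability.SpectralCurveConditions τ σ (ι x₀))
    (hdiscrete : IsDiscrete (LaxStability.gaugeOrbit B (ι x₀) ∩ Set.range ι)) :
    LaxStability.IsLyapunovStableFixedPoint v x₀ := by
  have : T2Space M := hι.isEmbedding.t2Space
  have : IsManifold (𝓡 d) 1 M := IsManifold.of_le (n := ∞) (by exact_mod_cast le_top)
  have hmem : ι x₀ ∈ LaxStability.gaugeOrbit B (ι x₀) ∩ Set.range ι :=
    ⟨LaxStability.self_mem_gaugeOrbit B _, x₀, rfl⟩
  -- The open set `u` meets the orbit inside the manifold only at `ι x₀`; its preimage is the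
  -- neighbourhood in which `x₀` is isolated in its level set.
  obtain ⟨u, hu, hux⟩ := isDiscrete_iff_forall_mem_exists_isOpen.mp hdiscrete _ hmem
  have hxu : ι x₀ ∈ u := (hux.symm.subset rfl).1
  have hcont : Continuous ι := hι.isEmbedding.continuous
  refine LaxStability.isLyapunovStableFixedPoint_of_isolated hv
    (LaxStability.continuous_spectralValues.comp hcont) ?_
    (hcont.continuousAt.preimage_mem_nhds (hu.mem_nhds hxu)) ?_
  · intro γ s hs hγ t ht t' ht'
    exact LaxStability.spectralValues_eq_of_lax (hι.contMDiff.mdifferentiable (by simp)) hLax hs hγ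
      ht ht'
  · intro x hx hΦ
    refine hι.isEmbedding.injective (hux.subset ⟨hx, ?_, x, rfl⟩)
    exact LaxStability.mem_gaugeOrbit_of_spectralValues_eq hB hτ hσ (hιB x) (hιB x₀) hcurve hΦ
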